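/- Let $n$ be a natural number, let $1<p<\infty$, let $q$ be the conjugate exponent, $\frac1p+\frac1q=1$, and put $p^*=\max\{p,q\}=\max\{p,\frac{p}{p-1}\}$. For a function $f\in C_0^\infty(\mathbb{R}^n)$ (smooth, compactly supported, real- or complex-valued) let $$U_f(x,y)=\int_{\mathbb{R}^n}p_y(x-z)\,f(z)\,dz,\qquad p_y(x)=\frac{\Gamma\left(\frac{n+1}{2}\right)}{\pi^{(n+1)/2}}\,\frac{y}{(|x|^2+y^2)^{(n+1)/2}},\qquad x\in\mathbb{R}^n,\ y>0,$$ be its Poisson extension to the upper half-space, and let $\nabla U_f=\left(\frac{\partial U_f}{\partial y},\frac{\partial U_f}{\partial x_1},\dots,\frac{\partial U_f}{\partial x_n}\right)$ be its full gradient, with Euclidean length $|\nabla U_f|$. Then for all $f,g\in C_0^\infty(\mathbb{R}^n)$, $$2\int_0^\infty\int_{\mathbb{R}^n}y\,|\nabla U_f(x,y)|\,|\nabla U_g(x,y)|\,dx\,dy\le(p^*-1)\,\|f\|_p\,\|g\|_q .$$ In particular, the integral on the left is finite. -/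

import Mathlib

open MeasureTheory
open scoped ContDiff Convolution

noncomputable section

/-- For `1 < p < ∞`, the number `p^* = max {p, p / (p - 1)}`, the larger of `p` and its conjugate
exponent. -/
def pStar (p : ℝ) : ℝ := max p (p / (p - 1))

/-- The Poisson kernel `p_y(x) = C_n y / (|x|^2 + y^2)^((n+1)/2)` of the upper half-space over
`ℝⁿ`, where `C_n = Γ((n+1)/2) / π^((n+1)/2)`. -/
def halfSpacePoissonKernel (n : ℕ) (y : ℝ) (x : EuclideanSpace ℝ (Fin n)) : ℝ :=
  Real.Gamma (((n : ℝ) + 1) / 2) / Real.pi ^ (((n : ℝ) + 1) / 2) * y /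
    (‖x‖ ^ 2 + y ^ 2) ^ (((n : ℝ) + 1) / 2)

/-- The Poisson extension `U_f(x, y) = (p_y * f)(x)`, for `y > 0`. -/
def poissonExtension {𝕜 : Type*} [RCLike 𝕜] {n : ℕ} (f : EuclideanSpace ℝ (Fin n) → 𝕜)
    (x : EuclideanSpace ℝ (Fin n)) (y : ℝ) : 𝕜 :=
  (halfSpacePoissonKernel n y ⋆[ContinuousLinearMap.lsmul ℝ ℝ, volume] f) x

/-- The full gradient `∇U = (∂U/∂y, ∂U/∂x₁, …, ∂U/∂xₙ)` of a function on the upper half-space,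
as a vector of `𝕜ⁿ⁺¹` with the Euclidean norm. -/
def fullGradient {𝕜 : Type*} [RCLike 𝕜] {n : ℕ} (U : EuclideanSpace ℝ (Fin n) → ℝ → 𝕜)
    (x : EuclideanSpace ℝ (Fin n)) (y : ℝ) : EuclideanSpace 𝕜 (Fin (n + 1)) :=
  WithLp.toLp 2 (Fin.cons (deriv (fun t : ℝ => U x t) y)
    (fun i : Fin n =>
      lineDeriv ℝ (fun z : EuclideanSpace ℝ (Fin n) => U z y) x (EuclideanSpace.single i 1)))

end

/-! The proof is the Bellman function method in Burkholder's form. Exchanging `(f, p)` and `(g, q)`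
reduces it to `1 < p ≤ 2`, where `p^* - 1 = 1 / (p - 1)`.

Burkholder's function `(|x| + |y|)^(p-1) (|y| - |x|/(p-1))` is concave in every direction `(h, k)`
with `|k| ≤ |h|` (`zigzagConcave_burkholderFun`), and a multiple of it majorizes `(|y|^p -
(|x|/(p-1))^p) / p` (`rpow_sub_le_burkholderFun`). Its partial Legendre transform `Q = bellmanFun p`
therefore is convex, is at most `(|x|/(p-1))^p / p + |ζ|^q / q`, and has second differences at least
`2 |h| |k|` in the direction `(h, k)` (`bellmanFun_midpoint`). Mollifying `Q` turns the last
property into a Hessian bound, and `two_mul_sqrt_le_sum_bilin` passes, without loss in the constant,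
from single directions to full gradients.

Let `F` be the mollified `Q`, shifted so that `F 0 = 0`, and let `u` be the Poisson extension of
`(f, g)`. Since `u` is harmonic, the Laplacian of `F ∘ u` is the trace of the Hessian of `F` along
`∇u`, hence at least `2 |∇U_f| |∇U_g|`. Green's formula with weight `y` bounds the integral of `y
Δ(F ∘ u)` by `∫ F(f, g)` (`lintegral_compPoissonHess_le`). Removing the mollification gives the
estimate with `‖f‖_p^p` and `‖g‖_q^q` added; optimizing over `f ↦ c f`, `g ↦ g / c` turns the sum
into the product of norms. -/

/-! ### Zigzag concavity of Burkholder's function. -/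

section Burkholder

variable {H : Type*} [NormedAddCommGroup H] [InnerProductSpace ℝ H]

/-- Concavity along all segments whose second component is no longer than the first one. -/
def ZigzagConcave (u : H → H → ℝ) : Prop :=
  ∀ (x₀ x₁ y₀ y₁ : H) (a b : ℝ), 0 ≤ a → 0 ≤ b → a + b = 1 → ‖y₁ - y₀‖ ≤ ‖x₁ - x₀‖ →
    a * u x₀ y₀ + b * u x₁ y₁ ≤ u (a • x₀ + b • x₁) (a • y₀ + b • y₁)

/-- The elementary zigzag-concave function, in terms of the norms of the two variables. -/
noncomputable def elemBurkholder (r s : ℝ) : ℝ := if r + s ≤ 1 then s ^ 2 - r ^ 2 else 1 - 2 * r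

theorem elemBurkholder_le_one_sub {r s : ℝ} (hs : 0 ≤ s) : elemBurkholder r s ≤ 1 - 2 * r := by
  unfold elemBurkholder
  split_ifs with h
  · nlinarith
  · exact le_rfl

theorem elemBurkholder_le_sq_sub_sq {r s : ℝ} (hs : 0 ≤ s) (hr : r ≤ 1) :
    elemBurkholder r s ≤ s ^ 2 - r ^ 2 := by
  unfold elemBurkholder
  split_ifs with h
  · exact le_rfl
  · nlinarith

/-- The right side is the tangent plane at `(x, y)` of `|y|^2 - |x|^2`, which lies above that
function in directions with `|dy| ≤ |dx|`. This suffices while `|x'| ≤ 1`. -/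
theorem elemBurkholder_le_tangent {x y x' y' : H} (hxy : ‖x‖ + ‖y‖ ≤ 1)
    (h : ‖y' - y‖ ≤ ‖x' - x‖) :
    elemBurkholder ‖x'‖ ‖y'‖ ≤
      ‖y‖ ^ 2 - ‖x‖ ^ 2 + 2 * inner ℝ y (y' - y) - 2 * inner ℝ x (x' - x) := by
  have e1 : ‖y'‖ ^ 2 = ‖y‖ ^ 2 + 2 * inner ℝ y (y' - y) + ‖y' - y‖ ^ 2 := by
    rw [← norm_add_sq_real, add_sub_cancel]
  have e2 : ‖x'‖ ^ 2 = ‖x‖ ^ 2 + 2 * inner ℝ x (x' - x) + ‖x' - x‖ ^ 2 := by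
    rw [← norm_add_sq_real, add_sub_cancel]
  have hd := norm_nonneg (y' - y)
  rcases le_or_gt ‖x'‖ 1 with hr | hr
  · have := elemBurkholder_le_sq_sub_sq (norm_nonneg y') hr
    nlinarith
  -- Here `1 - 2|x'| = (|x'| - 1)^2 - |x'|^2`, and the tangent plane is at least `(|x' - x| - |y|)^2
  -- - |x'|^2`. The two squares compare because `|x'| ≤ |x| + |x' - x|` and `|x| + |y| ≤ 1`.
  · have h1 := elemBurkholder_le_one_sub (r := ‖x'‖) (norm_nonneg y')
    have h2 : -(‖y‖ * ‖y' - y‖) ≤ inner ℝ y (y' - y) :=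
      (abs_le.1 (abs_real_inner_le_norm y (y' - y))).1
    have h3 : ‖x'‖ ≤ ‖x‖ + ‖x' - x‖ := by
      simpa using norm_add_le x (x' - x)
    have h4 : ‖y‖ * ‖y' - y‖ ≤ ‖y‖ * ‖x' - x‖ := by gcongr
    have h5 : ‖x'‖ - 1 ≤ ‖x' - x‖ - ‖y‖ := by linarith
    have h6 : (‖x'‖ - 1) ^ 2 ≤ (‖x' - x‖ - ‖y‖) ^ 2 := by gcongr
    nlinarith

theorem zigzagConcave_elemBurkholder :
    ZigzagConcave (fun x y : H => elemBurkholder ‖x‖ ‖y‖) := by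
  intro x₀ x₁ y₀ y₁ a b ha hb hab h
  obtain rfl : a = 1 - b := by linarith
  set x := (1 - b) • x₀ + b • x₁ with hx
  set y := (1 - b) • y₀ + b • y₁ with hy
  have ex0 : x₀ - x = -b • (x₁ - x₀) := by rw [hx]; module
  have ex1 : x₁ - x = (1 - b) • (x₁ - x₀) := by rw [hx]; module
  have ey0 : y₀ - y = -b • (y₁ - y₀) := by rw [hy]; module
  have ey1 : y₁ - y = (1 - b) • (y₁ - y₀) := by rw [hy]; module
  rcases le_or_gt (‖x‖ + ‖y‖) 1 with hi | ho
  · have t0 := elemBurkholder_le_tangent (x' := x₀) (y' := y₀) hi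
      (by rw [ex0, ey0, norm_smul, norm_smul]; gcongr)
    have t1 := elemBurkholder_le_tangent (x' := x₁) (y' := y₁) hi
      (by rw [ex1, ey1, norm_smul, norm_smul]; gcongr)
    rw [ex0, ey0, inner_smul_right, inner_smul_right] at t0
    rw [ex1, ey1, inner_smul_right, inner_smul_right] at t1
    have e : elemBurkholder ‖x‖ ‖y‖ = ‖y‖ ^ 2 - ‖x‖ ^ 2 := by
      simp [elemBurkholder, hi]
    simp only [e]
    nlinarith [mul_le_mul_of_nonneg_left t0 ha, mul_le_mul_of_nonneg_left t1 hb]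
  -- In the outer region the function equals its global majorant `1 - 2|x|`, which is concave.
  · have e : elemBurkholder ‖x‖ ‖y‖ = 1 - 2 * ‖x‖ := by
      simp [elemBurkholder, ho]
    have t0 := elemBurkholder_le_one_sub (r := ‖x₀‖) (norm_nonneg y₀)
    have t1 := elemBurkholder_le_one_sub (r := ‖x₁‖) (norm_nonneg y₁)
    have hn : ‖x‖ ≤ (1 - b) * ‖x₀‖ + b * ‖x₁‖ := by
      refine (norm_add_le _ _).trans (le_of_eq ?_)
      rw [norm_smul, norm_smul, Real.norm_of_nonneg ha, Real.norm_of_nonneg hb]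
    simp only [e]
    nlinarith [mul_le_mul_of_nonneg_left t0 ha, mul_le_mul_of_nonneg_left t1 hb]

/-- Burkholder's function for `1 < p ≤ 2`, up to a positive factor, in terms of the norms. -/
noncomputable def burkholderFun (p r s : ℝ) : ℝ := (r + s) ^ (p - 1) * (s - r / (p - 1))

/-- Represents Burkholder's function as a positive superposition of dilates of the elementary one.
The integrand changes form at `t = r + s`; beyond that point it is a multiple of `t^(p-3)`,
integrable at infinity only for `p < 2`. -/
theorem integral_elemBurkholder {p : ℝ} (hp : 1 < p) (hp2 : p < 2) {r s : ℝ} (hr : 0 ≤ r)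
    (hs : 0 ≤ s) :
    IntegrableOn (fun t : ℝ => t ^ (p - 1) * elemBurkholder (t⁻¹ * r) (t⁻¹ * s)) (Set.Ioi 0) ∧
    ∫ t in Set.Ioi (0 : ℝ), t ^ (p - 1) * elemBurkholder (t⁻¹ * r) (t⁻¹ * s) =
      2 / (p * (2 - p)) * burkholderFun p r s := by
  rcases (add_nonneg hr hs).eq_or_lt with h0 | hw
  · have hr0 : r = 0 := by linarith
    have hs0 : s = 0 := by linarith
    subst hr0 hs0
    have : p - 1 ≠ 0 := by linarith
    simp [elemBurkholder, burkholderFun, this]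
  set w := r + s with hwdef
  set F : ℝ → ℝ := fun t => t ^ (p - 1) * elemBurkholder (t⁻¹ * r) (t⁻¹ * s) with hF
  have c1 : Set.EqOn F (fun t => t ^ (p - 1) - 2 * r * t ^ (p - 2)) (Set.Ioo 0 w) := by
    intro t ht
    have h1 : ¬ (t⁻¹ * r + t⁻¹ * s ≤ 1) := by
      rw [← mul_add, ← div_eq_inv_mul, div_le_one ht.1]
      exact not_le.2 ht.2
    have h2 : t ^ (p - 1) = t ^ (p - 2) * t := by
      rw [show p - 1 = p - 2 + 1 by ring, Real.rpow_add_one ht.1.ne']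
    simp only [hF, elemBurkholder, h1, if_false]
    rw [h2]
    have := ht.1.ne'
    field_simp
  have c2 : Set.EqOn F (fun t => (s ^ 2 - r ^ 2) * t ^ (p - 3)) (Set.Ioi w) := by
    intro t ht
    have ht0 : 0 < t := hw.trans ht
    have h1 : (t⁻¹ * r + t⁻¹ * s ≤ 1) := by
      rw [← mul_add, ← div_eq_inv_mul, div_le_one ht0]
      exact le_of_lt ht
    have h2 : t ^ (p - 1) = t ^ (p - 3) * t ^ 2 := by
      rw [show p - 1 = p - 3 + (2 : ℕ) by push_cast; ring, Real.rpow_add_natCast ht0.ne']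
    simp only [hF, elemBurkholder, h1, if_true]
    rw [h2]
    field_simp
  have i11 : IntegrableOn (fun t : ℝ => t ^ (p - 1)) (Set.Ioc 0 w) :=
    (intervalIntegrable_iff_integrableOn_Ioc_of_le hw.le).1
      (intervalIntegral.intervalIntegrable_rpow' (by linarith))
  have i12 : IntegrableOn (fun t : ℝ => t ^ (p - 2)) (Set.Ioc 0 w) :=
    (intervalIntegrable_iff_integrableOn_Ioc_of_le hw.le).1
      (intervalIntegral.intervalIntegrable_rpow' (by linarith))
  have i1 : IntegrableOn F (Set.Ioc 0 w) := by
    rw [integrableOn_Ioc_iff_integrableOn_Ioo]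
    refine IntegrableOn.congr_fun ?_ c1.symm measurableSet_Ioo
    rw [← integrableOn_Ioc_iff_integrableOn_Ioo]
    exact i11.sub (i12.const_mul (2 * r))
  have i2 : IntegrableOn F (Set.Ioi w) := by
    refine IntegrableOn.congr_fun ?_ c2.symm measurableSet_Ioi
    exact (integrableOn_Ioi_rpow_of_lt (by linarith) hw).const_mul _
  refine ⟨?_, ?_⟩
  · rw [← Set.Ioc_union_Ioi_eq_Ioi hw.le]
    exact i1.union i2
  rw [← Set.Ioc_union_Ioi_eq_Ioi hw.le,
    setIntegral_union Set.Ioc_disjoint_Ioi_same measurableSet_Ioi i1 i2,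
    setIntegral_congr_fun measurableSet_Ioi c2, integral_Ioc_eq_integral_Ioo,
    setIntegral_congr_fun measurableSet_Ioo c1, ← integral_Ioc_eq_integral_Ioo,
    integral_sub i11 (i12.const_mul (2 * r)), integral_const_mul, integral_const_mul,
    integral_Ioi_rpow_of_lt (by linarith) hw, ← intervalIntegral.integral_of_le hw.le,
    ← intervalIntegral.integral_of_le hw.le, integral_rpow (Or.inl (by linarith)),
    integral_rpow (Or.inl (by linarith))]
  have e1 : w ^ (p - 1 + 1) = w ^ (p - 3 + 1) * w ^ 2 := by
    rw [← Real.rpow_add_natCast hw.ne']; congr 1; push_cast; ring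
  have e2 : w ^ (p - 2 + 1) = w ^ (p - 3 + 1) * w := by
    rw [← Real.rpow_add_one hw.ne']; congr 1; ring
  have e3 : w ^ (p - 1) = w ^ (p - 3 + 1) * w := by
    rw [← Real.rpow_add_one hw.ne']; congr 1; ring
  rw [burkholderFun, ← hwdef, e1, e2, e3, Real.zero_rpow (by linarith), Real.zero_rpow (by linarith)]
  set A := w ^ (p - 3 + 1)
  have n1 : p - 1 + 1 ≠ 0 := by linarith
  have n2 : p - 2 + 1 ≠ 0 := by linarith
  have n3 : p - 3 + 1 ≠ 0 := by linarith
  have n4 : 2 - p ≠ 0 := by linarith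
  have n5 : p - 1 ≠ 0 := by linarith
  have n6 : p ≠ 0 := by linarith
  rw [show p - 1 + 1 = p by ring, show p - 2 + 1 = p - 1 by ring,
    show p - 3 + 1 = -(2 - p) by ring, hwdef]
  field_simp
  ring

/-- Dilations and positive superpositions preserve zigzag concavity, so the integral representation
settles `p < 2`. For `p = 2` the function is `|y|^2 - |x|^2` and the polarization identity suffices.
-/
theorem zigzagConcave_burkholderFun {p : ℝ} (hp : 1 < p) (hp2 : p ≤ 2) :
    ZigzagConcave (fun x y : H => burkholderFun p ‖x‖ ‖y‖) := by
  rcases hp2.eq_or_lt with rfl | hp2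
  · intro x₀ x₁ y₀ y₁ a b ha hb hab h
    have e : ∀ r s : ℝ, burkholderFun 2 r s = s ^ 2 - r ^ 2 := by
      intro r s
      rw [burkholderFun, show (2 : ℝ) - 1 = 1 by norm_num, Real.rpow_one]; ring
    have key : ∀ v w : H, ‖a • v + b • w‖ ^ 2 =
        a * ‖v‖ ^ 2 + b * ‖w‖ ^ 2 - a * b * ‖w - v‖ ^ 2 := by
      intro v w
      rw [norm_add_sq_real, norm_sub_sq_real, inner_smul_left, inner_smul_right, norm_smul,
        norm_smul, Real.norm_of_nonneg ha, Real.norm_of_nonneg hb, real_inner_comm v w]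
      obtain rfl : a = 1 - b := by linarith
      simp only [conj_trivial]
      ring
    simp only [e, key]
    have : ‖y₁ - y₀‖ ^ 2 ≤ ‖x₁ - x₀‖ ^ 2 := by gcongr
    nlinarith [mul_le_mul_of_nonneg_left this (mul_nonneg ha hb)]
  · intro x₀ x₁ y₀ y₁ a b ha hb hab h
    set x := a • x₀ + b • x₁ with hx
    set y := a • y₀ + b • y₁ with hy
    obtain ⟨j0, k0⟩ := integral_elemBurkholder hp hp2 (norm_nonneg x₀) (norm_nonneg y₀)
    obtain ⟨j1, k1⟩ := integral_elemBurkholder hp hp2 (norm_nonneg x₁) (norm_nonneg y₁)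
    obtain ⟨j, k⟩ := integral_elemBurkholder hp hp2 (norm_nonneg x) (norm_nonneg y)
    have hpos : 0 < 2 / (p * (2 - p)) := by
      have : 0 < 2 - p := by linarith
      positivity
    have main := setIntegral_mono_on ((j0.const_mul a).add (j1.const_mul b)) j
      measurableSet_Ioi (fun t ht => by
        have ht : 0 < t := ht
        have := zigzagConcave_elemBurkholder (t⁻¹ • x₀) (t⁻¹ • x₁) (t⁻¹ • y₀) (t⁻¹ • y₁) a b
          ha hb hab (by
            rw [← smul_sub, ← smul_sub, norm_smul, norm_smul]; gcongr)
        rw [smul_comm a, smul_comm b, smul_comm a, smul_comm b, ← smul_add, ← smul_add, ← hx,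
          ← hy] at this
        simp only [norm_smul, norm_inv, Real.norm_of_nonneg ht.le] at this
        have := mul_le_mul_of_nonneg_left this (Real.rpow_nonneg ht.le (p - 1))
        simp only [Pi.add_apply]
        linarith)
    simp only [Pi.add_apply] at main
    rw [integral_add (j0.const_mul a) (j1.const_mul b), integral_const_mul, integral_const_mul,
      k0, k1, k] at main
    refine le_of_mul_le_mul_left ?_ hpos
    linarith

end Burkholder

/-! ### Burkholder's pointwise majorization. -/

section Majorant

/-- One-variable form of the majorization. The difference of the two sides vanishes at `v = 1` and
has its minimum there: the sign of its derivative is that of `v^(p-2) - (1 + p(v-1))^(p-2)`, and `1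
+ p(v-1)` crosses `v` at `v = 1`. The lower bound on `v` keeps `1 + p(v-1)` nonnegative. -/
theorem rpow_le_one_add_burkholder {p : ℝ} (hp : 1 < p) (hp2 : p ≤ 2) {v : ℝ}
    (hv : (p - 1) / p ≤ v) :
    (1 + p * (v - 1)) ^ p ≤ 1 + p ^ 2 * (v - 1) * v ^ (p - 1) := by
  have hp0 : 0 < p := by linarith
  set D : ℝ → ℝ := fun v => 1 + p ^ 2 * (v - 1) * v ^ (p - 1) - (1 + p * (v - 1)) ^ p with hD
  set D' : ℝ → ℝ := fun v => p ^ 2 * (1 + p * (v - 1)) *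
    (v ^ (p - 2) - (1 + p * (v - 1)) ^ (p - 2)) with hD'
  have hcont : ContinuousOn D (Set.Ici ((p - 1) / p)) := by
    have h1 : Continuous fun v : ℝ => v ^ (p - 1) := Real.continuous_rpow_const (by linarith)
    have h2 : Continuous fun v : ℝ => v ^ p := Real.continuous_rpow_const (by linarith)
    have h3 : Continuous fun v : ℝ => (1 + p * (v - 1)) ^ p := h2.comp (by fun_prop)
    exact (((continuous_const.add ((by fun_prop : Continuous fun v : ℝ =>
      p ^ 2 * (v - 1)).mul h1)).sub h3)).continuousOn
  have hT : ∀ v, (p - 1) / p < v → 0 < 1 + p * (v - 1) := by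
    intro v hv
    rw [div_lt_iff₀ hp0] at hv
    linarith
  have hv0 : ∀ v, (p - 1) / p < v → 0 < v := fun v hv =>
    lt_of_le_of_lt (div_nonneg (by linarith) hp0.le) hv
  have hder : ∀ v, (p - 1) / p < v → HasDerivAt D (D' v) v := by
    intro v hv
    have h0 := hv0 v hv
    have hT0 := hT v hv
    have hl : HasDerivAt (fun v : ℝ => 1 + p * (v - 1)) p v := by
      simpa using (((hasDerivAt_id v).sub_const 1).const_mul p).const_add 1
    have hl2 : HasDerivAt (fun v : ℝ => p ^ 2 * (v - 1)) (p ^ 2) v := by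
      simpa using (((hasDerivAt_id v).sub_const 1).const_mul (p ^ 2))
    have h1 : HasDerivAt (fun v : ℝ => v ^ (p - 1)) ((p - 1) * v ^ (p - 1 - 1)) v :=
      Real.hasDerivAt_rpow_const (Or.inl h0.ne')
    have h2 := hl.rpow_const (p := p) (Or.inl hT0.ne')
    refine (((hl2.mul h1).const_add 1).sub h2).congr_deriv ?_
    have e1 : v ^ (p - 1) = v ^ (p - 2) * v := by
      rw [← Real.rpow_add_one h0.ne']; congr 1; ring
    have e2 : (1 + p * (v - 1)) ^ (p - 1) = (1 + p * (v - 1)) ^ (p - 2) * (1 + p * (v - 1)) := by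
      rw [← Real.rpow_add_one hT0.ne']; congr 1; ring
    simp only [hD']
    rw [e1, e2, show p - 1 - 1 = p - 2 by ring]
    ring
  have hD1 : D 1 = 0 := by simp [hD]
  suffices h : 0 ≤ D v by simp only [hD] at h; linarith
  rw [← hD1]
  rcases le_total v 1 with h | h
  · have : AntitoneOn D (Set.Icc ((p - 1) / p) 1) := by
      refine antitoneOn_of_hasDerivWithinAt_nonpos (convex_Icc _ _)
        (hcont.mono fun x hx => hx.1) (f' := D')
        (fun x hx => ?_) (fun x hx => ?_)
      · rw [interior_Icc] at hx
        exact (hder x hx.1).hasDerivWithinAt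
      · rw [interior_Icc] at hx
        refine mul_nonpos_of_nonneg_of_nonpos ?_ ?_
        · have := hT x hx.1; positivity
        · rw [sub_nonpos]
          refine Real.rpow_le_rpow_of_nonpos (hT x hx.1) ?_ (by linarith)
          nlinarith [hx.2]
    exact this ⟨hv, h⟩ ⟨hv.trans h, le_rfl⟩ h
  · have h1p : (p - 1) / p < 1 := by rw [div_lt_one hp0]; linarith
    have : MonotoneOn D (Set.Ici 1) := by
      refine monotoneOn_of_hasDerivWithinAt_nonneg (convex_Ici _)
        (hcont.mono fun x hx => h1p.le.trans hx) (f' := D')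
        (fun x hx => ?_) (fun x hx => ?_)
      · rw [interior_Ici] at hx
        exact (hder x (h1p.trans hx)).hasDerivWithinAt
      · rw [interior_Ici] at hx
        have hx1 : 1 < x := hx
        refine mul_nonneg ?_ ?_
        · have := hT x (h1p.trans hx); positivity
        · rw [sub_nonneg]
          refine Real.rpow_le_rpow_of_nonpos (by linarith) ?_ (by linarith)
          nlinarith
    exact this (Set.mem_Ici.2 le_rfl) h h

/-- Burkholder's majorization `|y|^p - (p^*-1)^p |x|^p ≤ α_p U(x, y)`, for `1 < p ≤ 2`. -/
theorem rpow_sub_le_burkholderFun {p : ℝ} (hp : 1 < p) (hp2 : p ≤ 2) {r s : ℝ} (hr : 0 ≤ r)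
    (hs : 0 ≤ s) :
    (s ^ p - (r / (p - 1)) ^ p) / p ≤ p ^ (1 - p) * burkholderFun p r s := by
  have hp0 : 0 < p := by linarith
  have hp1 : 0 < p - 1 := by linarith
  rw [div_le_iff₀ hp0]
  rcases hr.eq_or_lt with rfl | hr
  · rw [burkholderFun, zero_add, zero_div, sub_zero, Real.zero_rpow hp0.ne', sub_zero]
    rcases hs.eq_or_lt with rfl | hs
    · simp [hp0.ne']
    · have e : s ^ (p - 1) * s = s ^ p := by
        rw [← Real.rpow_add_one hs.ne']; congr 1; ring
      have e' : p ^ (1 - p) * p = p ^ (2 - p) := by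
        rw [← Real.rpow_add_one hp0.ne']; congr 1; ring
      calc s ^ p = 1 * s ^ p := (one_mul _).symm
        _ ≤ p ^ (2 - p) * s ^ p := by
          gcongr
          exact Real.one_le_rpow hp.le (by linarith)
        _ = _ := by rw [e, ← e']; ring
  -- By homogeneity, divide by `c`. The choice of `v` makes `1 + p(v-1) = s / c` and `v = (r + s) /
  -- (c p)`.
  · set c := r / (p - 1) with hc
    have hc0 : 0 < c := by positivity
    set v := (p - 1 + s / c) / p with hv
    have key := rpow_le_one_add_burkholder hp hp2 (v := v) (by
      rw [hv]; gcongr; linarith [div_nonneg hs hc0.le])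
    have e1 : 1 + p * (v - 1) = s / c := by rw [hv]; field_simp; ring
    have e2 : p ^ 2 * (v - 1) = p * (s / c - 1) := by rw [hv]; field_simp; ring
    have e3 : v = (r + s) / (c * p) := by rw [hv, hc]; field_simp
    have hv0 : 0 ≤ v := by rw [e3]; positivity
    rw [e1, e2, Real.div_rpow hs hc0.le, div_le_iff₀ (by positivity), e3,
      Real.div_rpow (by positivity) (by positivity), Real.mul_rpow hc0.le hp0.le] at key
    have e4 : c ^ p = c ^ (p - 1) * c := by
      rw [← Real.rpow_add_one hc0.ne']; congr 1; ring
    have e5 : p ^ (1 - p) = (p ^ (p - 1))⁻¹ := by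
      rw [← Real.rpow_neg hp0.le]; congr 1; ring
    rw [burkholderFun, e5, ← hc]
    have : 0 < c ^ (p - 1) := by positivity
    have : 0 < p ^ (p - 1) := by positivity
    rw [sub_le_iff_le_add]
    refine key.trans (le_of_eq ?_)
    rw [e4]
    field_simp
    ring

end Majorant

/-! ### The Bellman function as a partial Legendre transform. -/

section Bellman

variable {H : Type*} [NormedAddCommGroup H] [InnerProductSpace ℝ H]

/-- The partial Legendre transform of Burkholder's function in its second variable. -/
noncomputable def bellmanFun (p : ℝ) (X : H × H) : ℝ :=
  ⨆ y : H, (inner ℝ y X.2 - p ^ (1 - p) * burkholderFun p ‖X.1‖ ‖y‖)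

variable {p q : ℝ}

/-- The majorization replaces Burkholder's function by a difference of powers, and Young's
inequality absorbs the inner product. -/
theorem inner_sub_burkholderFun_le (hpq : p.HolderConjugate q) (hp2 : p ≤ 2) (X : H × H) (y : H) :
    inner ℝ y X.2 - p ^ (1 - p) * burkholderFun p ‖X.1‖ ‖y‖ ≤
      (‖X.1‖ / (p - 1)) ^ p / p + ‖X.2‖ ^ q / q := by
  have h1 := rpow_sub_le_burkholderFun hpq.lt hp2 (norm_nonneg X.1) (norm_nonneg y)
  have h2 := Real.young_inequality_of_nonneg (norm_nonneg y) (norm_nonneg X.2) hpq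
  have h3 := real_inner_le_norm y X.2
  rw [sub_div] at h1
  linarith

theorem bddAbove_bellmanFun (hpq : p.HolderConjugate q) (hp2 : p ≤ 2) (X : H × H) :
    BddAbove (Set.range fun y : H =>
      inner ℝ y X.2 - p ^ (1 - p) * burkholderFun p ‖X.1‖ ‖y‖) :=
  ⟨_, by rintro _ ⟨y, rfl⟩; exact inner_sub_burkholderFun_le hpq hp2 X y⟩

theorem le_bellmanFun (hpq : p.HolderConjugate q) (hp2 : p ≤ 2) (X : H × H) (y : H) :
    inner ℝ y X.2 - p ^ (1 - p) * burkholderFun p ‖X.1‖ ‖y‖ ≤ bellmanFun p X :=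
  le_ciSup (bddAbove_bellmanFun hpq hp2 X) y

theorem bellmanFun_le (hpq : p.HolderConjugate q) (hp2 : p ≤ 2) (X : H × H) :
    bellmanFun p X ≤ (‖X.1‖ / (p - 1)) ^ p / p + ‖X.2‖ ^ q / q :=
  ciSup_le fun y => inner_sub_burkholderFun_le hpq hp2 X y

theorem bellmanFun_neg (X : H × H) : bellmanFun p (-X) = bellmanFun p X := by
  unfold bellmanFun
  rw [← (Equiv.neg H).iSup_comp]
  simp

/-- For fixed `y` the expression under the supremum is convex in `X`: Burkholder's function is
concave in its first variable alone, a zigzag direction with zero second component. -/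
theorem convexOn_bellmanFun (hpq : p.HolderConjugate q) (hp2 : p ≤ 2) :
    ConvexOn ℝ Set.univ (bellmanFun p : H × H → ℝ) := by
  refine ⟨convex_univ, ?_⟩
  intro X _ Y _ a b ha hb hab
  refine ciSup_le fun y => ?_
  have hz := zigzagConcave_burkholderFun hpq.lt hp2 X.1 Y.1 y y a b ha hb hab (by simp)
  have hy : a • y + b • y = y := by rw [← add_smul, hab, one_smul]
  rw [hy] at hz
  have h1 := mul_le_mul_of_nonneg_left (le_bellmanFun hpq hp2 X y) ha
  have h2 := mul_le_mul_of_nonneg_left (le_bellmanFun hpq hp2 Y y) hb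
  have hp : 0 ≤ p ^ (1 - p) := Real.rpow_nonneg hpq.nonneg _
  have h3 := mul_le_mul_of_nonneg_left hz hp
  simp only [Prod.fst_add, Prod.snd_add, Prod.smul_fst, Prod.smul_snd, inner_add_right,
    inner_smul_right, smul_eq_mul] at *
  linarith

theorem bellmanFun_midpoint (hpq : p.HolderConjugate q) (hp2 : p ≤ 2) (X K : H × H) :
    2 * bellmanFun p X + 2 * (‖K.1‖ * ‖K.2‖) ≤ bellmanFun p (X + K) + bellmanFun p (X - K) := by
  -- The competitor `y` at `X` is moved to `y ± l` at `X ± K`. Taking `l` parallel to `K.2` with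
  -- `|l| = |K.1|` keeps `(K.1, l)` a zigzag direction and makes the gain `⟨l, K.2⟩` maximal.
  obtain ⟨l, hl, hlk⟩ : ∃ l : H, ‖l‖ ≤ ‖K.1‖ ∧ inner ℝ l K.2 = ‖K.1‖ * ‖K.2‖ := by
    rcases eq_or_ne K.2 0 with h | h
    · exact ⟨0, by simp, by simp [h]⟩
    · have h' := norm_ne_zero_iff.2 h
      refine ⟨(‖K.1‖ / ‖K.2‖) • K.2, ?_, ?_⟩
      · rw [norm_smul, norm_div, norm_norm, norm_norm, div_mul_cancel₀ _ h']
      · rw [inner_smul_left, real_inner_self_eq_norm_sq]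
        simp only [conj_trivial]
        field_simp
  have : bellmanFun p X ≤ (bellmanFun p (X + K) + bellmanFun p (X - K)) / 2 - ‖K.1‖ * ‖K.2‖ := by
    refine ciSup_le fun y => ?_
    have hz := zigzagConcave_burkholderFun hpq.lt hp2 (X.1 - K.1) (X.1 + K.1) (y - l) (y + l)
      (1 / 2) (1 / 2) (by norm_num) (by norm_num) (by norm_num) (by
        rw [show y + l - (y - l) = (2 : ℝ) • l by module,
          show X.1 + K.1 - (X.1 - K.1) = (2 : ℝ) • K.1 by module, norm_smul, norm_smul]
        gcongr)
    rw [show (1 / 2 : ℝ) • (X.1 - K.1) + (1 / 2 : ℝ) • (X.1 + K.1) = X.1 by module,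
      show (1 / 2 : ℝ) • (y - l) + (1 / 2 : ℝ) • (y + l) = y by module] at hz
    have h1 := le_bellmanFun hpq hp2 (X + K) (y + l)
    have h2 := le_bellmanFun hpq hp2 (X - K) (y - l)
    have hp : 0 ≤ p ^ (1 - p) := Real.rpow_nonneg hpq.nonneg _
    have h3 := mul_le_mul_of_nonneg_left hz hp
    simp only [Prod.fst_add, Prod.snd_add, Prod.fst_sub, Prod.snd_sub, inner_add_right,
      inner_sub_right, inner_add_left, inner_sub_left] at h1 h2
    linarith
  linarith

end Bellman

/-! ### Smoothing the Bellman function. -/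

section Mollify

variable {V : Type*} [NormedAddCommGroup V] [NormedSpace ℝ V] [FiniteDimensional ℝ V]

/-- Mollification preserves convexity, parity and a quantitative midpoint convexity. -/
theorem exists_contDiff_convex_approx {Q N : V → ℝ} (hQ : ConvexOn ℝ Set.univ Q)
    (hneg : ∀ X, Q (-X) = Q X) (hmid : ∀ X K, 2 * Q X + N K ≤ Q (X + K) + Q (X - K))
    (R : ℝ) {δ : ℝ} (hδ : 0 < δ) :
    ∃ F : V → ℝ, ContDiff ℝ ∞ F ∧ ConvexOn ℝ Set.univ F ∧ (∀ X, F (-X) = F X) ∧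
      (∀ X K, 2 * F X + N K ≤ F (X + K) + F (X - K)) ∧
      ∀ X ∈ Metric.closedBall (0 : V) R, |F X - Q X| ≤ δ := by
  borelize V
  have hQc : Continuous Q := by
    rw [← continuousOn_univ]; exact hQ.continuousOn isOpen_univ
  let μ : Measure V := Measure.addHaar
  obtain ⟨r, hr, hrδ⟩ : ∃ r > 0, ∀ X ∈ Metric.closedBall (0 : V) R, ∀ Y, dist Y X < r →
      dist (Q Y) (Q X) ≤ δ := by
    have hcpt : IsCompact (Metric.closedBall (0 : V) R) := isCompact_closedBall _ _
    have := hcpt.uniformContinuousAt_of_continuousAt Q (fun a _ => hQc.continuousAt)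
      (Metric.dist_mem_uniformity hδ)
    obtain ⟨r, hr, h⟩ := Metric.mem_uniformity_dist.1 this
    refine ⟨r, hr, fun X hX Y hY => ?_⟩
    have := h (by rwa [dist_comm] at hY : dist X Y < r) hX
    rw [dist_comm]
    exact le_of_lt this
  let φ : ContDiffBump (0 : V) := ⟨r / 2, r, by positivity, by linarith⟩
  let ψ : V → ℝ := φ.normed μ
  have hψ0 : ∀ t, 0 ≤ ψ t := φ.nonneg_normed
  have hψ1 : ∫ t, ψ t ∂μ = 1 := φ.integral_normed
  have hint : ∀ X, Integrable (fun t => ψ t * Q (X - t)) μ := fun X =>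
    (φ.continuous_normed.mul (hQc.comp (by fun_prop))).integrable_of_hasCompactSupport
      φ.hasCompactSupport_normed.mul_right
  refine ⟨fun X => ∫ t, ψ t * Q (X - t) ∂μ, ?_, ⟨convex_univ, ?_⟩, ?_, ?_, ?_⟩
  · exact φ.hasCompactSupport_normed.contDiff_convolution_left (ContinuousLinearMap.lsmul ℝ ℝ)
      φ.contDiff_normed hQc.locallyIntegrable
  · intro X _ Y _ a b ha hb hab
    simp only [smul_eq_mul]
    rw [← integral_const_mul, ← integral_const_mul, ← integral_add ((hint X).const_mul a)
      ((hint Y).const_mul b)]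
    refine integral_mono (hint _) (((hint X).const_mul a).add ((hint Y).const_mul b)) fun t => ?_
    have h := hQ.2 (Set.mem_univ (X - t)) (Set.mem_univ (Y - t)) ha hb hab
    have e : a • (X - t) + b • (Y - t) = a • X + b • Y - t := by
      obtain rfl : a = 1 - b := by linarith
      module
    rw [e] at h
    have := mul_le_mul_of_nonneg_left h (hψ0 t)
    simp only [smul_eq_mul] at this
    linarith
  -- Parity survives because the bump is even.
  · intro X
    have := integral_neg_eq_self (fun t => ψ t * Q (X - t)) μ
    simp only
    rw [← this]
    congr 1
    ext t
    simp only [ψ, φ.normed_neg]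
    rw [← hneg (X - -t)]
    congr 2
    abel
  -- The defect `N K` does not depend on the base point, so averaging with total mass one leaves it
  -- unchanged.
  · intro X K
    have hN : N K = ∫ t, ψ t * N K ∂μ := by rw [integral_mul_const, hψ1, one_mul]
    have hNi : Integrable (fun t => ψ t * N K) μ := φ.integrable_normed.mul_const _
    simp only
    rw [hN, ← integral_const_mul, ← integral_add ((hint X).const_mul 2) hNi,
      ← integral_add (hint _) (hint _)]
    refine integral_mono (((hint X).const_mul 2).add hNi) ((hint _).add (hint _)) fun t => ?_
    have h := hmid (X - t) K
    rw [show X - t + K = X + K - t by abel, show X - t - K = X - K - t by abel] at h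
    have := mul_le_mul_of_nonneg_left h (hψ0 t)
    linarith
  · intro X hX
    have := φ.dist_normed_convolution_le (μ := μ) (x₀ := X) (g := Q) (ε := δ)
      hQc.aestronglyMeasurable (fun Y hY => hrδ X hX Y hY)
    exact this

end Mollify

/-! ### From second differences to the Hessian. -/

section SecondDerivative

variable {V : Type*} [NormedAddCommGroup V] [NormedSpace ℝ V]

theorem hasDerivAt_comp_add_smul {F : V → ℝ} (hF : ContDiff ℝ 2 F) (X K : V) (t : ℝ) :
    HasDerivAt (fun t : ℝ => F (X + t • K)) (fderiv ℝ F (X + t • K) K) t := by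
  have h1 : HasDerivAt (fun t : ℝ => X + t • K) K t := by
    simpa using ((hasDerivAt_id t).smul_const K).const_add X
  exact ((hF.differentiable (by norm_num)) _).hasFDerivAt.comp_hasDerivAt t h1

theorem hasDerivAt_fderiv_comp_add_smul {F : V → ℝ} (hF : ContDiff ℝ 2 F) (X K L : V) (t : ℝ) :
    HasDerivAt (fun t : ℝ => fderiv ℝ F (X + t • K) L)
      (fderiv ℝ (fderiv ℝ F) (X + t • K) K L) t := by
  have h1 : HasDerivAt (fun t : ℝ => X + t • K) K t := by
    simpa using ((hasDerivAt_id t).smul_const K).const_add X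
  have h2 : ContDiff ℝ 1 (fderiv ℝ F) := hF.fderiv_right (by norm_num)
  have h3 := ((h2.differentiable (by norm_num)) (X + t • K)).hasFDerivAt.comp_hasDerivAt t h1
  exact h3.clm_apply (hasDerivAt_const t L) |>.congr_deriv (by simp)

/-- Quantitative midpoint convexity gives a lower bound for the Hessian. -/
theorem le_fderiv_fderiv_of_midpoint {F N : V → ℝ} (hF : ContDiff ℝ 2 F)
    (hN : ∀ (t : ℝ) (K : V), N (t • K) = t ^ 2 * N K)
    (hmid : ∀ X K, 2 * F X + N K ≤ F (X + K) + F (X - K)) (X K : V) :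
    N K ≤ fderiv ℝ (fderiv ℝ F) X K K := by
  by_contra! hlt
  obtain ⟨c, hc1, hc2⟩ := exists_between hlt
  -- With `c` strictly between the Hessian value and `N K`, the function `ψ` has negative second
  -- derivative at `0`, hence a local maximum. The midpoint inequality gives `ψ t - ψ 0 ≥ t^2 (N K -
  -- c) > 0` for `t ≠ 0`, a contradiction.
  set ψ : ℝ → ℝ := fun t => F (X + t • K) + F (X + t • (-K)) - t ^ 2 * c with hψ
  have hd : ∀ t, HasDerivAt ψ
      (fderiv ℝ F (X + t • K) K + fderiv ℝ F (X + t • (-K)) (-K) - 2 * t * c) t := fun t =>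
    ((hasDerivAt_comp_add_smul hF X K t).add (hasDerivAt_comp_add_smul hF X (-K) t)).sub
      (((hasDerivAt_pow 2 t).mul_const c).congr_deriv (by simp))
  have hd' : deriv ψ = fun t => fderiv ℝ F (X + t • K) K + fderiv ℝ F (X + t • (-K)) (-K)
      - 2 * t * c := funext fun t => (hd t).deriv
  have hdd : HasDerivAt (deriv ψ) (2 * (fderiv ℝ (fderiv ℝ F) X K K - c)) 0 := by
    rw [hd']
    have h1 := hasDerivAt_fderiv_comp_add_smul hF X K K 0
    have h2 := hasDerivAt_fderiv_comp_add_smul hF X (-K) (-K) 0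
    have h3 : HasDerivAt (fun t : ℝ => 2 * t * c) (2 * c) 0 := by
      simpa using ((hasDerivAt_id (0 : ℝ)).const_mul 2).mul_const c
    refine ((h1.add h2).sub h3).congr_deriv ?_
    simp
    ring
  have hmax : IsLocalMax ψ 0 := by
    refine isLocalMax_of_deriv_deriv_neg ?_ ?_ (hd 0).continuousAt
    · rw [hdd.deriv]; linarith
    · rw [hd']; simp
  have hev : ∀ᶠ t : ℝ in nhdsWithin 0 {0}ᶜ, False := by
    filter_upwards [hmax.filter_mono nhdsWithin_le_nhds, self_mem_nhdsWithin] with t ht ht0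
    have ht0 : t ≠ 0 := ht0
    have h1 := hmid X (t • K)
    rw [hN] at h1
    simp only [hψ, smul_neg, ← sub_eq_add_neg, zero_smul, add_zero, sub_zero] at ht
    have : 0 < t ^ 2 := by positivity
    nlinarith
  exact (hev.frequently).exists.elim fun _ h => h

end SecondDerivative

/-! ### From single directions to full gradients. -/

section QuadraticForms

/-- Among the signed sums of finitely many vectors, one has a value of a quadratic form not
exceeding the sum of its values at these vectors. -/
theorem exists_signs_le {V ι : Type*} [AddCommGroup V] [Module ℝ V] (B : V →ₗ[ℝ] V →ₗ[ℝ] ℝ)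
    (Y : ι → V) (s : Finset ι) :
    ∃ ε : ι → ℝ, (∀ j, ε j * ε j = 1) ∧
      B (∑ j ∈ s, ε j • Y j) (∑ j ∈ s, ε j • Y j) ≤ ∑ j ∈ s, B (Y j) (Y j) := by
  classical
  induction s using Finset.induction_on with
  | empty => exact ⟨fun _ => 1, by simp, by simp⟩
  | insert i s hi ih =>
    obtain ⟨ε, hε, h⟩ := ih
    set Z := ∑ j ∈ s, ε j • Y j with hZ
    -- The new sign `c` is chosen so that the cross terms with the sum already built are
    -- nonpositive.
    have key : ∀ c : ℝ, c * c = 1 → c * (B (Y i) Z + B Z (Y i)) ≤ 0 →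
        ∃ ε : ι → ℝ, (∀ j, ε j * ε j = 1) ∧
        B (∑ j ∈ insert i s, ε j • Y j) (∑ j ∈ insert i s, ε j • Y j)
          ≤ ∑ j ∈ insert i s, B (Y j) (Y j) := by
      intro c hc hle
      refine ⟨Function.update ε i c, fun j => ?_, ?_⟩
      · rcases eq_or_ne j i with rfl | hj
        · simpa using hc
        · simpa [hj] using hε j
      · rw [Finset.sum_insert hi, Finset.sum_insert hi]
        have : ∑ j ∈ s, Function.update ε i c j • Y j = Z := by
          refine Finset.sum_congr rfl fun j hj => ?_
          rw [Function.update_of_ne (by rintro rfl; exact hi hj)]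
        rw [this, Function.update_self]
        simp only [map_add, LinearMap.add_apply, map_smul, LinearMap.smul_apply, smul_eq_mul]
        nlinarith [congrArg (· * B (Y i) (Y i)) hc]
    rcases le_total (B (Y i) Z + B Z (Y i)) 0 with h0 | h0
    · exact key 1 (by norm_num) (by linarith)
    · exact key (-1) (by norm_num) (by linarith)

/-- Allows an auxiliary form to be diagonalized on the family by a rotation without changing the
sums of `B`. -/
theorem sum_bilin_orthogonal {V ι : Type*} [AddCommGroup V] [Module ℝ V] [Fintype ι]
    [DecidableEq ι] (B : V →ₗ[ℝ] V →ₗ[ℝ] ℝ) (X : ι → V) (U : Matrix ι ι ℝ)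
    (hU : U * U.transpose = 1) :
    ∑ j, B (∑ i, U i j • X i) (∑ i, U i j • X i) = ∑ i, B (X i) (X i) := by
  have hU' : ∀ i k, ∑ j, U i j * U k j = if i = k then 1 else 0 := by
    intro i k
    have := congrFun (congrFun hU i) k
    rwa [Matrix.mul_apply, Matrix.one_apply] at this
  simp only [map_sum, LinearMap.sum_apply, map_smul, LinearMap.smul_apply, smul_eq_mul,
    Finset.mul_sum]
  calc ∑ j, ∑ i, ∑ k, U i j * (U k j * B (X k) (X i))
      = ∑ i, ∑ k, ∑ j, U i j * (U k j * B (X k) (X i)) := by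
        rw [Finset.sum_comm]
        exact Finset.sum_congr rfl fun i _ => Finset.sum_comm
    _ = ∑ i, ∑ k, (if i = k then 1 else 0) * B (X k) (X i) := by
        refine Finset.sum_congr rfl fun i _ => Finset.sum_congr rfl fun k _ => ?_
        rw [← hU' i k, Finset.sum_mul]
        exact Finset.sum_congr rfl fun j _ => by ring
    _ = _ := by simp

/-- If a quadratic form on `E × E` dominates `2 |h| |k|`, then its sums over finite families
dominate twice the product of the Euclidean norms of the families. -/
theorem two_mul_sqrt_le_sum_bilin {E ι : Type*} [NormedAddCommGroup E] [InnerProductSpace ℝ E]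
    [Fintype ι] (B : (E × E) →ₗ[ℝ] (E × E) →ₗ[ℝ] ℝ)
    (hB : ∀ K : E × E, 2 * (‖K.1‖ * ‖K.2‖) ≤ B K K) (X : ι → E × E) :
    2 * (√(∑ j, ‖(X j).1‖ ^ 2) * √(∑ j, ‖(X j).2‖ ^ 2)) ≤ ∑ j, B (X j) (X j) := by
  classical
  have hB0 : ∀ K, 0 ≤ B K K := fun K => le_trans (by positivity) (hB K)
  set a := ∑ j, ‖(X j).1‖ ^ 2 with ha
  set c := ∑ j, ‖(X j).2‖ ^ 2 with hc
  have ha0 : 0 ≤ a := Finset.sum_nonneg fun _ _ => by positivity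
  have hc0 : 0 ≤ c := Finset.sum_nonneg fun _ _ => by positivity
  rcases hc0.eq_or_lt with h | hcpos
  · rw [← h]; simpa using Finset.sum_nonneg fun j _ => hB0 (X j)
  -- Summing `hB` over `j` fails, since Cauchy–Schwarz goes the wrong way. Instead one vector `Z` is
  -- built whose components have the same length ratio `√l` as the whole family. With this `l` the
  -- form `G = |h|^2 - l |k|^2` has total `a - l c = 0` on the family.
  set l := a / c with hl
  have hl0 : 0 ≤ l := div_nonneg ha0 hc0
  let I : E →ₗ[ℝ] E →ₗ[ℝ] ℝ := innerₗ E
  let I1 : (E × E) →ₗ[ℝ] (E × E) →ₗ[ℝ] ℝ := I.compl₁₂ (LinearMap.fst ℝ E E) (LinearMap.fst ℝ E E)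
  let I2 : (E × E) →ₗ[ℝ] (E × E) →ₗ[ℝ] ℝ := I.compl₁₂ (LinearMap.snd ℝ E E) (LinearMap.snd ℝ E E)
  have hI1 : ∀ K, I1 K K = ‖K.1‖ ^ 2 := fun K => real_inner_self_eq_norm_sq K.1
  have hI2 : ∀ K, I2 K K = ‖K.2‖ ^ 2 := fun K => real_inner_self_eq_norm_sq K.2
  let G := I1 - l • I2
  have hGs : ∀ K L, G K L = G L K := by
    intro K L
    change inner ℝ K.1 L.1 - l * inner ℝ K.2 L.2 = inner ℝ L.1 K.1 - l * inner ℝ L.2 K.2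
    rw [real_inner_comm, real_inner_comm K.2]
  let D : Matrix ι ι ℝ := Matrix.of fun i k => G (X i) (X k)
  have hD : D.IsHermitian := by
    ext i k
    simp [D, hGs (X i) (X k)]
  let U : Matrix ι ι ℝ := hD.eigenvectorUnitary
  have hUU : U * U.transpose = 1 := by
    have := Matrix.mem_unitaryGroup_iff.1 hD.eigenvectorUnitary.2
    rwa [Matrix.star_eq_conjTranspose, Matrix.conjTranspose_eq_transpose_of_trivial] at this
  have hdiag : U.transpose * D * U = Matrix.diagonal hD.eigenvalues := by
    have := hD.conjStarAlgAut_star_eigenvectorUnitary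
    rw [Unitary.conjStarAlgAut_apply] at this
    simpa [Matrix.star_eq_conjTranspose, Matrix.conjTranspose_eq_transpose_of_trivial] using this
  let Y : ι → E × E := fun j => ∑ i, U i j • X i
  have hY : ∀ j k, j ≠ k → G (Y j) (Y k) = 0 := by
    intro j k hjk
    have h1 := congrFun (congrFun hdiag j) k
    rw [Matrix.diagonal_apply_ne _ hjk, Matrix.mul_apply] at h1
    rw [← h1]
    simp only [Y, map_sum, LinearMap.sum_apply, map_smul, LinearMap.smul_apply, smul_eq_mul,
      Matrix.mul_apply, Matrix.transpose_apply, D, Matrix.of_apply]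
    refine Finset.sum_congr rfl fun i _ => ?_
    rw [Finset.sum_mul, Finset.mul_sum]
    exact Finset.sum_congr rfl fun _ _ => by ring
  have hG0 : ∑ j, G (Y j) (Y j) = 0 := by
    rw [sum_bilin_orthogonal G X U hUU]
    simp only [G, LinearMap.sub_apply, LinearMap.smul_apply, hI1, hI2, smul_eq_mul,
      Finset.sum_sub_distrib, ← Finset.mul_sum, ← ha, ← hc, hl]
    field_simp
    ring
  -- The rotated family is `G`-orthogonal, so every signed sum is `G`-null. The signs are therefore
  -- free to be chosen to make `B - 2√l |k|^2` small; at the resulting null vector `Z`, `hB` says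
  -- that this form is nonnegative.
  obtain ⟨ε, hε, hle⟩ := exists_signs_le (B - (2 * √l) • I2) Y Finset.univ
  set Z := ∑ j, ε j • Y j with hZ
  have hGZ : G Z Z = 0 := by
    rw [hZ]
    simp only [map_sum, LinearMap.sum_apply, map_smul, LinearMap.smul_apply, smul_eq_mul]
    rw [← hG0]
    refine Finset.sum_congr rfl fun j _ => ?_
    rw [Finset.sum_eq_single j, ← mul_assoc, hε, one_mul]
    · intro k _ hk
      rw [hY _ _ hk]; simp
    · simp
  have hZ1 : ‖Z.1‖ = √l * ‖Z.2‖ := by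
    have : ‖Z.1‖ ^ 2 = l * ‖Z.2‖ ^ 2 := by
      have : I1 Z Z - l * I2 Z Z = 0 := hGZ
      rw [hI1, hI2] at this; linarith
    rw [← Real.sqrt_sq (norm_nonneg Z.1), this, Real.sqrt_mul hl0, Real.sqrt_sq (norm_nonneg _)]
  have hZB := hB Z
  have hsum : ∑ j, (B - (2 * √l) • I2) (Y j) (Y j) = ∑ j, B (X j) (X j) - 2 * √l * c := by
    rw [sum_bilin_orthogonal (B - (2 * √l) • I2) X U hUU]
    simp only [LinearMap.sub_apply, LinearMap.smul_apply, hI2, smul_eq_mul,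
      Finset.sum_sub_distrib, ← Finset.mul_sum, ← hc]
  rw [hsum] at hle
  have h1 : (B - (2 * √l) • I2) Z Z = B Z Z - 2 * √l * ‖Z.2‖ ^ 2 := by
    simp only [LinearMap.sub_apply, LinearMap.smul_apply, hI2, smul_eq_mul]
  rw [h1] at hle
  have h2 : √a * √c = √l * c := by
    rw [hl, Real.sqrt_div ha0]
    nth_rewrite 3 [← Real.mul_self_sqrt hc0]
    have := (Real.sqrt_pos.2 hcpos).ne'
    field_simp
  rw [h2]
  rw [hZ1] at hZB
  nlinarith

end QuadraticForms

/-! ### The Poisson kernel: derivatives, bounds, harmonicity, total mass. -/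

section PoissonKernel

variable {n : ℕ}

/-- The normalizing constant of the Poisson kernel. -/
noncomputable def poissonConst (n : ℕ) : ℝ :=
  Real.Gamma (((n : ℝ) + 1) / 2) / Real.pi ^ (((n : ℝ) + 1) / 2)

theorem poissonConst_pos (n : ℕ) : 0 < poissonConst n :=
  div_pos (Real.Gamma_pos_of_pos (by positivity)) (by positivity)

theorem halfSpacePoissonKernel_eq (y : ℝ) (x : EuclideanSpace ℝ (Fin n)) :
    halfSpacePoissonKernel n y x =
      poissonConst n * y * (‖x‖ ^ 2 + y ^ 2) ^ (-(((n : ℝ) + 1) / 2)) := by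
  rw [halfSpacePoissonKernel, Real.rpow_neg (by positivity), div_eq_mul_inv, poissonConst]

/-- The derivative of the Poisson kernel at `(x, y)` in the direction `(v, τ)`. -/
noncomputable def poissonKernelDeriv (n : ℕ) (d : EuclideanSpace ℝ (Fin n) × ℝ) (y : ℝ)
    (x : EuclideanSpace ℝ (Fin n)) : ℝ :=
  poissonConst n * (d.2 * (‖x‖ ^ 2 + y ^ 2) ^ (-(((n : ℝ) + 1) / 2)) -
    ((n : ℝ) + 1) * y * (inner ℝ x d.1 + y * d.2) *
      (‖x‖ ^ 2 + y ^ 2) ^ (-(((n : ℝ) + 1) / 2) - 1))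

/-- The second derivative of the Poisson kernel at `(x, y)` in the unit direction `(v, τ)`. -/
noncomputable def poissonKernelDeriv₂ (n : ℕ) (d : EuclideanSpace ℝ (Fin n) × ℝ) (y : ℝ)
    (x : EuclideanSpace ℝ (Fin n)) : ℝ :=
  poissonConst n * (-(2 * ((n : ℝ) + 1) * d.2 * (inner ℝ x d.1 + y * d.2) + ((n : ℝ) + 1) * y) *
      (‖x‖ ^ 2 + y ^ 2) ^ (-(((n : ℝ) + 1) / 2) - 1) +
    ((n : ℝ) + 1) * ((n : ℝ) + 3) * y * (inner ℝ x d.1 + y * d.2) ^ 2 *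
      (‖x‖ ^ 2 + y ^ 2) ^ (-(((n : ℝ) + 1) / 2) - 1 - 1))

variable {d : EuclideanSpace ℝ (Fin n) × ℝ}

theorem hasDerivAt_norm_sq_add_sq (hd : ‖d.1‖ ^ 2 + d.2 ^ 2 = 1) (x : EuclideanSpace ℝ (Fin n))
    (y t : ℝ) :
    HasDerivAt (fun t : ℝ => ‖x + t • d.1‖ ^ 2 + (y + t * d.2) ^ 2)
      (2 * (inner ℝ (x + t • d.1) d.1 + (y + t * d.2) * d.2)) t ∧
    HasDerivAt (fun t : ℝ => inner ℝ (x + t • d.1) d.1 + (y + t * d.2) * d.2) 1 t := by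
  have h1 : HasDerivAt (fun t : ℝ => x + t • d.1) d.1 t := by
    simpa using ((hasDerivAt_id t).smul_const d.1).const_add x
  have h2 : HasDerivAt (fun t : ℝ => y + t * d.2) d.2 t := by
    simpa using ((hasDerivAt_id t).mul_const d.2).const_add y
  constructor
  · refine (h1.norm_sq.add (h2.pow 2)).congr_deriv ?_
    simp
    ring
  · refine ((h1.inner ℝ (hasDerivAt_const t d.1)).add (h2.mul_const d.2)).congr_deriv ?_
    rw [inner_zero_right, zero_add, real_inner_self_eq_norm_sq, ← hd]
    ring

theorem hasDerivAt_halfSpacePoissonKernel (hd : ‖d.1‖ ^ 2 + d.2 ^ 2 = 1)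
    (x : EuclideanSpace ℝ (Fin n)) {y t : ℝ} (ht : 0 < y + t * d.2) :
    HasDerivAt (fun t : ℝ => halfSpacePoissonKernel n (y + t * d.2) (x + t • d.1))
      (poissonKernelDeriv n d (y + t * d.2) (x + t • d.1)) t := by
  simp only [halfSpacePoissonKernel_eq]
  have h2 : HasDerivAt (fun t : ℝ => y + t * d.2) d.2 t := by
    simpa using ((hasDerivAt_id t).mul_const d.2).const_add y
  have hρ := (hasDerivAt_norm_sq_add_sq hd x y t).1
  have hρ0 : 0 < ‖x + t • d.1‖ ^ 2 + (y + t * d.2) ^ 2 := by positivity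
  have h3 := hρ.rpow_const (p := -(((n : ℝ) + 1) / 2)) (Or.inl hρ0.ne')
  refine ((h2.const_mul (poissonConst n)).mul h3).congr_deriv ?_
  rw [poissonKernelDeriv]
  ring

theorem hasDerivAt_poissonKernelDeriv (hd : ‖d.1‖ ^ 2 + d.2 ^ 2 = 1)
    (x : EuclideanSpace ℝ (Fin n)) {y t : ℝ} (ht : 0 < y + t * d.2) :
    HasDerivAt (fun t : ℝ => poissonKernelDeriv n d (y + t * d.2) (x + t • d.1))
      (poissonKernelDeriv₂ n d (y + t * d.2) (x + t • d.1)) t := by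
  simp only [poissonKernelDeriv]
  have h2 : HasDerivAt (fun t : ℝ => y + t * d.2) d.2 t := by
    simpa using ((hasDerivAt_id t).mul_const d.2).const_add y
  obtain ⟨hρ, hσ⟩ := hasDerivAt_norm_sq_add_sq hd x y t
  have hρ0 : 0 < ‖x + t • d.1‖ ^ 2 + (y + t * d.2) ^ 2 := by positivity
  have h3 := hρ.rpow_const (p := -(((n : ℝ) + 1) / 2)) (Or.inl hρ0.ne')
  have h4 := hρ.rpow_const (p := -(((n : ℝ) + 1) / 2) - 1) (Or.inl hρ0.ne')
  refine (((h3.const_mul d.2).sub (((h2.const_mul ((n : ℝ) + 1)).mul hσ).mul h4)).const_mul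
    (poissonConst n)).congr_deriv ?_
  rw [poissonKernelDeriv₂]
  simp only [Pi.mul_apply]
  ring

theorem continuous_halfSpacePoissonKernel {y : ℝ} (hy : 0 < y) :
    Continuous (halfSpacePoissonKernel n y) := by
  have : ∀ x : EuclideanSpace ℝ (Fin n), ‖x‖ ^ 2 + y ^ 2 ≠ 0 := fun x => by positivity
  simp only [funext (halfSpacePoissonKernel_eq (n := n) y)]
  exact continuous_const.mul (Continuous.rpow_const (by fun_prop) fun x => Or.inl (this x))

theorem continuous_poissonKernelDeriv {y : ℝ} (hy : 0 < y) :
    Continuous (poissonKernelDeriv n d y) := by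
  have : ∀ x : EuclideanSpace ℝ (Fin n), ‖x‖ ^ 2 + y ^ 2 ≠ 0 := fun x => by positivity
  unfold poissonKernelDeriv
  have h : ∀ r : ℝ, Continuous fun x : EuclideanSpace ℝ (Fin n) => (‖x‖ ^ 2 + y ^ 2) ^ r :=
    fun r => Continuous.rpow_const (by fun_prop) fun x => Or.inl (this x)
  have h1 := h (-(((n : ℝ) + 1) / 2))
  have h2 := h (-(((n : ℝ) + 1) / 2) - 1)
  fun_prop

theorem continuous_poissonKernelDeriv₂ {y : ℝ} (hy : 0 < y) :
    Continuous (poissonKernelDeriv₂ n d y) := by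
  have : ∀ x : EuclideanSpace ℝ (Fin n), ‖x‖ ^ 2 + y ^ 2 ≠ 0 := fun x => by positivity
  unfold poissonKernelDeriv₂
  have h : ∀ r : ℝ, Continuous fun x : EuclideanSpace ℝ (Fin n) => (‖x‖ ^ 2 + y ^ 2) ^ r :=
    fun r => Continuous.rpow_const (by fun_prop) fun x => Or.inl (this x)
  have h1 := h (-(((n : ℝ) + 1) / 2) - 1)
  have h2 := h (-(((n : ℝ) + 1) / 2) - 1 - 1)
  fun_prop

/-- An integrable function dominating the Poisson kernels at heights in a compact interval. -/
noncomputable def poissonMajorant (n : ℕ) (x : EuclideanSpace ℝ (Fin n)) : ℝ :=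
  (1 + ‖x‖ ^ 2) ^ (-((n : ℝ) + 1) / 2)

theorem integrable_poissonMajorant : Integrable (poissonMajorant n) :=
  integrable_rpow_neg_one_add_norm_sq (by simp)

theorem continuous_poissonMajorant : Continuous (poissonMajorant n) :=
  Continuous.rpow_const (by fun_prop) fun x => Or.inl (by positivity)

theorem poissonMajorant_nonneg (x : EuclideanSpace ℝ (Fin n)) : 0 ≤ poissonMajorant n x :=
  Real.rpow_nonneg (by positivity) _

theorem poissonMajorant_le_one (x : EuclideanSpace ℝ (Fin n)) : poissonMajorant n x ≤ 1 :=
  Real.rpow_le_one_of_one_le_of_nonpos (by nlinarith [sq_nonneg ‖x‖])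
    (by have : (0 : ℝ) ≤ n := n.cast_nonneg
        linarith)

-- Locally uniform domination in `y` by one integrable function of `x`, as needed to differentiate
-- under the integral sign and to integrate the derivatives over the boundary space.
set_option maxHeartbeats 400000 in
theorem exists_poissonKernel_bound (hd : ‖d.1‖ ^ 2 + d.2 ^ 2 = 1) {y₀ Y : ℝ} (hy₀ : 0 < y₀) :
    ∃ C : ℝ, 0 ≤ C ∧ ∀ y ∈ Set.Icc y₀ Y, ∀ x : EuclideanSpace ℝ (Fin n),
      |halfSpacePoissonKernel n y x| ≤ C * poissonMajorant n x ∧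
      |poissonKernelDeriv n d y x| ≤ C * poissonMajorant n x ∧
      |poissonKernelDeriv₂ n d y x| ≤ C * poissonMajorant n x := by
  set N : ℝ := (n : ℝ) + 1 with hN
  have hN0 : 0 < N := by positivity
  set m : ℝ := min 1 (y₀ ^ 2) with hm
  have hm0 : 0 < m := lt_min one_pos (by positivity)
  set M : ℝ := m ^ (-(N / 2)) with hM
  have hM0 : 0 < M := Real.rpow_pos_of_pos hm0 _
  set c := poissonConst n with hc
  have hc0 : 0 < c := poissonConst_pos n
  -- The three summands serve the kernel, its first derivative and its second derivative; `M`
  -- compares `ρ^(-N/2)` with the majorant.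
  refine ⟨c * (|Y| + (1 + N) + (3 * N + N * (N + 2)) / y₀) * M, by positivity, ?_⟩
  intro y hy x
  have hy0 : 0 < y := hy₀.trans_le hy.1
  set ρ := ‖x‖ ^ 2 + y ^ 2 with hρ
  have hρ0 : 0 < ρ := by positivity
  set A := ρ ^ (-(N / 2)) with hA
  have hA0 : 0 < A := Real.rpow_pos_of_pos hρ0 _
  have hAM : A ≤ M * poissonMajorant n x := by
    have h1 : m * (1 + ‖x‖ ^ 2) ≤ ρ := by
      have h2 : m ≤ 1 := min_le_left _ _
      have h3 : m ≤ y₀ ^ 2 := min_le_right _ _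
      have h4 : y₀ ^ 2 ≤ y ^ 2 := by gcongr; exact hy.1
      nlinarith [mul_le_mul_of_nonneg_right h2 (sq_nonneg ‖x‖)]
    rw [poissonMajorant, hM, show -((n : ℝ) + 1) / 2 = -(N / 2) by rw [hN]; ring,
      ← Real.mul_rpow hm0.le (by positivity)]
    exact Real.rpow_le_rpow_of_nonpos (by positivity) h1 (by linarith)
  have hA1 : ρ ^ (-(N / 2) - 1) = A / ρ := by rw [Real.rpow_sub_one hρ0.ne']
  have hA2 : ρ ^ (-(N / 2) - 1 - 1) = A / ρ / ρ := by
    rw [Real.rpow_sub_one hρ0.ne', Real.rpow_sub_one hρ0.ne']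
  set σ := inner ℝ x d.1 + y * d.2 with hσ
  have hτ : |d.2| ≤ 1 := by
    rw [← sq_le_one_iff_abs_le_one]; nlinarith [sq_nonneg ‖d.1‖]
  have hσρ : σ ^ 2 ≤ ρ := by
    have h1 := abs_real_inner_le_norm x d.1
    have h2 : σ ^ 2 ≤ (‖x‖ * ‖d.1‖ + y * |d.2|) ^ 2 := by
      rw [sq_le_sq, abs_of_nonneg (a := ‖x‖ * ‖d.1‖ + y * |d.2|) (by positivity)]
      refine (abs_add_le _ _).trans ?_
      rw [abs_mul y, abs_of_pos hy0]
      gcongr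
    -- Lagrange's identity for the vectors `(|x|, y)` and `(|d.1|, |d.2|)`, the latter of unit
    -- length.
    have h3 : (‖x‖ * ‖d.1‖ + y * |d.2|) ^ 2 + (‖x‖ * |d.2| - y * ‖d.1‖) ^ 2 = ρ := by
      have : ‖d.1‖ ^ 2 + |d.2| ^ 2 = 1 := by rw [sq_abs]; exact hd
      linear_combination (‖x‖ ^ 2 + y ^ 2) * this
    nlinarith [sq_nonneg (‖x‖ * |d.2| - y * ‖d.1‖)]
  have hyρ : y ^ 2 ≤ ρ := by nlinarith [sq_nonneg ‖x‖]
  have hyσ : y * |σ| ≤ ρ := by nlinarith [sq_nonneg (y - |σ|), sq_abs σ]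
  have hy₀σ : |σ| / ρ ≤ 1 / y₀ := by
    rw [div_le_div_iff₀ hρ0 hy₀]
    nlinarith [mul_le_mul_of_nonneg_right hy.1 (abs_nonneg σ)]
  have hy₀y : y / ρ ≤ 1 / y₀ := by
    rw [div_le_div_iff₀ hρ0 hy₀]
    nlinarith [mul_le_mul_of_nonneg_right hy.1 hy0.le]
  have fin : ∀ B : ℝ, 0 ≤ B → B ≤ |Y| + (1 + N) + (3 * N + N * (N + 2)) / y₀ →
      c * (B * A) ≤ c * (|Y| + (1 + N) + (3 * N + N * (N + 2)) / y₀) * M * poissonMajorant n x := by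
    intro B hB0 hB
    rw [mul_assoc, mul_assoc]
    have := poissonMajorant_nonneg x
    gcongr
  refine ⟨?_, ?_, ?_⟩
  · rw [halfSpacePoissonKernel_eq, ← hρ, ← hN, ← hA, ← hc, abs_of_nonneg (by positivity), mul_assoc]
    refine fin y hy0.le ?_
    have : y ≤ |Y| := hy.2.trans (le_abs_self Y)
    have : 0 ≤ (3 * N + N * (N + 2)) / y₀ := by positivity
    linarith
  · rw [poissonKernelDeriv, ← hρ, ← hN, ← hA, ← hc, hA1, ← hσ, abs_mul, abs_of_pos hc0]
    refine le_trans ?_ (fin (1 + N) (by positivity) ?_)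
    · gcongr
      have e : d.2 * A - N * y * σ * (A / ρ) = (d.2 - N * (y * σ / ρ)) * A := by ring
      rw [e, abs_mul, abs_of_pos hA0]
      gcongr
      refine (abs_sub _ _).trans ?_
      rw [abs_mul, abs_of_pos hN0, abs_div, abs_mul, abs_of_pos hy0, abs_of_pos hρ0]
      have := mul_le_mul_of_nonneg_left ((div_le_one hρ0).2 hyσ) hN0.le
      linarith
    · have : 0 ≤ (3 * N + N * (N + 2)) / y₀ := by positivity
      linarith [abs_nonneg Y]
  · rw [poissonKernelDeriv₂, ← hρ, ← hN, ← hc, hA2, hA1, ← hσ, abs_mul, abs_of_pos hc0]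
    refine le_trans ?_ (fin ((3 * N + N * (N + 2)) / y₀) (by positivity) ?_)
    · gcongr
      have e : -(2 * N * d.2 * σ + N * y) * (A / ρ) + N * (↑n + 3) * y * σ ^ 2 * (A / ρ / ρ) =
          (-(2 * N * (d.2 * (σ / ρ))) - N * (y / ρ) + N * (N + 2) * ((y / ρ) * (σ ^ 2 / ρ))) * A := by
        rw [hN]; ring
      rw [e, abs_mul, abs_of_pos hA0]
      gcongr
      refine (abs_add_le _ _).trans ?_
      have h1 : |d.2 * (σ / ρ)| ≤ 1 / y₀ := by
        rw [abs_mul, abs_div, abs_of_pos hρ0]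
        calc |d.2| * (|σ| / ρ) ≤ 1 * (1 / y₀) := by gcongr
          _ = _ := one_mul _
      have h2 : (y / ρ) * (σ ^ 2 / ρ) ≤ 1 / y₀ := by
        calc (y / ρ) * (σ ^ 2 / ρ) ≤ (1 / y₀) * 1 := by
              gcongr; exact (div_le_one hρ0).2 hσρ
          _ = _ := mul_one _
      have h3 : |-(2 * N * (d.2 * (σ / ρ))) - N * (y / ρ)| ≤ 2 * N * (1 / y₀) + N * (1 / y₀) := by
        refine (abs_sub _ _).trans ?_
        rw [abs_neg, abs_mul (2 * N), abs_of_pos (by positivity : (0 : ℝ) < 2 * N),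
          abs_of_pos (by positivity : 0 < N * (y / ρ))]
        gcongr
      have h4 : |N * (N + 2) * ((y / ρ) * (σ ^ 2 / ρ))| ≤ N * (N + 2) * (1 / y₀) := by
        rw [abs_of_nonneg (by positivity)]
        gcongr
      refine (add_le_add h3 h4).trans (le_of_eq ?_)
      ring
    · linarith [abs_nonneg Y]

/-- The coordinate directions of the upper half-space, the vertical one first. -/
noncomputable def halfSpaceDir (n : ℕ) : Fin (n + 1) → EuclideanSpace ℝ (Fin n) × ℝ :=
  Fin.cons (0, 1) fun i => (EuclideanSpace.single i 1, 0)

theorem halfSpaceDir_unit (j : Fin (n + 1)) :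
    ‖(halfSpaceDir n j).1‖ ^ 2 + (halfSpaceDir n j).2 ^ 2 = 1 := by
  refine Fin.cases ?_ (fun i => ?_) j <;> simp [halfSpaceDir]

/-- The Poisson kernel is harmonic. -/
theorem sum_poissonKernelDeriv₂ {y : ℝ} (hy : 0 < y) (x : EuclideanSpace ℝ (Fin n)) :
    ∑ j, poissonKernelDeriv₂ n (halfSpaceDir n j) y x = 0 := by
  have hρ0 : 0 < ‖x‖ ^ 2 + y ^ 2 := by positivity
  have hx : ∑ i, x i ^ 2 = ‖x‖ ^ 2 := (EuclideanSpace.real_norm_sq_eq x).symm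
  simp only [poissonKernelDeriv₂]
  rw [Real.rpow_sub_one hρ0.ne' (-(((n : ℝ) + 1) / 2) - 1)]
  set A := (‖x‖ ^ 2 + y ^ 2) ^ (-(((n : ℝ) + 1) / 2) - 1)
  rw [Fin.sum_univ_succ]
  simp only [halfSpaceDir, Fin.cons_zero, Fin.cons_succ, inner_zero_right, mul_one, mul_zero,
    zero_add, add_zero, zero_mul, EuclideanSpace.inner_single_right, one_mul, conj_trivial]
  rw [← Finset.mul_sum, Finset.sum_add_distrib, Finset.sum_const, ← Finset.sum_mul,
    ← Finset.mul_sum, hx, Finset.card_univ, Fintype.card_fin, nsmul_eq_mul]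
  field_simp
  ring

theorem integrable_halfSpacePoissonKernel {y : ℝ} (hy : 0 < y) :
    Integrable (halfSpacePoissonKernel n y) := by
  obtain ⟨C, -, hC⟩ := exists_poissonKernel_bound (halfSpaceDir_unit (n := n) 0) (Y := y) hy
  refine (integrable_poissonMajorant.const_mul C).mono'
    (continuous_halfSpacePoissonKernel hy).aestronglyMeasurable (Filter.Eventually.of_forall ?_)
  intro x
  exact (hC y ⟨le_rfl, le_rfl⟩ x).1

theorem halfSpacePoissonKernel_nonneg {y : ℝ} (hy : 0 < y) (x : EuclideanSpace ℝ (Fin n)) :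
    0 ≤ halfSpacePoissonKernel n y x := by
  rw [halfSpacePoissonKernel_eq]
  have := poissonConst_pos n
  positivity

/-- Subordination: `Γ(a) ρ^(-a)` is the integral of `s^(a-1) e^(-ρ s)`, so after Fubini the integral
in `x` is Gaussian and the remaining one in `s` is a Gamma integral at `1/2`. -/
theorem integral_halfSpacePoissonKernel {y : ℝ} (hy : 0 < y) :
    ∫ x, halfSpacePoissonKernel n y x = 1 := by
  set a : ℝ := ((n : ℝ) + 1) / 2 with ha
  have ha0 : 0 < a := by positivity
  have hΓ : 0 < Real.Gamma a := Real.Gamma_pos_of_pos ha0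
  let F : ℝ → EuclideanSpace ℝ (Fin n) → ℝ := fun s x =>
    s ^ (a - 1) * Real.exp (-((‖x‖ ^ 2 + y ^ 2) * s))
  have hFx : ∀ s ∈ Set.Ioi (0 : ℝ), F s = fun x =>
      s ^ (a - 1) * Real.exp (-(y ^ 2 * s)) * Real.exp (-s * ‖x‖ ^ 2) := by
    intro s _
    ext x
    simp only [F]
    rw [mul_assoc, ← Real.exp_add]
    congr 2
    ring
  have hG : ∀ s ∈ Set.Ioi (0 : ℝ), ∫ x, F s x =
      Real.pi ^ ((n : ℝ) / 2) * (s ^ ((1 : ℝ) / 2 - 1) * Real.exp (-(y ^ 2 * s))) := by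
    intro s hs
    have hs : 0 < s := hs
    rw [hFx s hs, integral_const_mul, GaussianFourier.integral_rexp_neg_mul_sq_norm hs,
      finrank_euclideanSpace_fin, Real.div_rpow Real.pi_pos.le hs.le,
      show (1 : ℝ) / 2 - 1 = a - 1 - n / 2 by rw [ha]; ring, Real.rpow_sub hs (a - 1)]
    ring
  have hGi : IntegrableOn (fun s : ℝ => s ^ ((1 : ℝ) / 2 - 1) * Real.exp (-(y ^ 2 * s)))
      (Set.Ioi 0) := by
    -- A non-integrable function has Bochner integral `0`, but the closed formula is positive. The
    -- same argument gives integrability of `F s` below.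
    by_contra hne
    have h1 := Real.integral_rpow_mul_exp_neg_mul_Ioi (a := 1 / 2) (r := y ^ 2) (by norm_num)
      (by positivity)
    rw [integral_undef hne] at h1
    have : 0 < (1 / y ^ 2) ^ ((1 : ℝ) / 2) * Real.Gamma (1 / 2) :=
      mul_pos (by positivity) (Real.Gamma_pos_of_pos (by norm_num))
    linarith
  have hFi : Integrable (Function.uncurry F) ((volume.restrict (Set.Ioi 0)).prod volume) := by
    rw [integrable_prod_iff]
    · refine ⟨?_, ?_⟩
      · refine (ae_restrict_iff' measurableSet_Ioi).2 (Filter.Eventually.of_forall fun s hs => ?_)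
        simp only [Function.uncurry]
        change Integrable (F s)
        by_contra hne
        have h1 := hG s hs
        rw [integral_undef hne] at h1
        have hs : 0 < s := hs
        have : 0 < Real.pi ^ ((n : ℝ) / 2) *
          (s ^ ((1 : ℝ) / 2 - 1) * Real.exp (-(y ^ 2 * s))) := by positivity
        linarith
      · refine Integrable.congr (hGi.const_mul (Real.pi ^ ((n : ℝ) / 2))) ?_
        refine (ae_restrict_iff' measurableSet_Ioi).2 (Filter.Eventually.of_forall fun s hs => ?_)
        simp only [Function.uncurry]
        rw [← hG s hs]
        congr 1
        ext x
        have hs : 0 < s := hs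
        rw [Real.norm_of_nonneg]
        positivity
    · refine Measurable.aestronglyMeasurable ?_
      unfold Function.uncurry
      simp only [F]
      fun_prop
  have hsw := integral_integral_swap hFi
  rw [setIntegral_congr_fun measurableSet_Ioi hG, integral_const_mul,
    Real.integral_rpow_mul_exp_neg_mul_Ioi (by norm_num) (by positivity)] at hsw
  have hin : ∀ x : EuclideanSpace ℝ (Fin n), ∫ s in Set.Ioi 0, F s x =
      Real.Gamma a * (‖x‖ ^ 2 + y ^ 2) ^ (-a) := by
    intro x
    simp only [F]
    rw [Real.integral_rpow_mul_exp_neg_mul_Ioi ha0 (by positivity), one_div, Real.inv_rpow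
      (by positivity), Real.rpow_neg (by positivity), mul_comm]
  simp only [hin] at hsw
  rw [integral_const_mul] at hsw
  simp only [halfSpacePoissonKernel_eq]
  rw [integral_const_mul]
  have e1 : ((1 : ℝ) / y ^ 2) ^ ((1 : ℝ) / 2) = y⁻¹ := by
    rw [← Real.sqrt_eq_rpow, one_div, Real.sqrt_inv, Real.sqrt_sq hy.le]
  have e2 : Real.pi ^ a = Real.pi ^ ((n : ℝ) / 2) * √Real.pi := by
    rw [Real.sqrt_eq_rpow, ← Real.rpow_add Real.pi_pos]
    congr 1
    rw [ha]; ring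
  rw [e1, Real.Gamma_one_half_eq] at hsw
  have hI : ∫ x : EuclideanSpace ℝ (Fin n), (‖x‖ ^ 2 + y ^ 2) ^ (-a) =
      Real.pi ^ a * y⁻¹ / Real.Gamma a := by
    rw [eq_div_iff hΓ.ne', mul_comm, ← hsw, e2]; ring
  rw [← ha, hI, poissonConst, ← ha]
  have : 0 < Real.pi ^ a := by positivity
  field_simp

end PoissonKernel

/-! ### Integration by parts on the half-line. -/

section ConvexOneDim

/-- For a convex function on the half-line with values in `[0, M]`, `∫ y m''(y) dy ≤ M`. -/
theorem lintegral_mul_deriv₂_le {m m' m'' : ℝ → ℝ} {M : ℝ}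
    (h1 : ∀ y, 0 < y → HasDerivAt m (m' y) y) (h2 : ∀ y, 0 < y → HasDerivAt m' (m'' y) y)
    (hm'' : ∀ y, 0 < y → 0 ≤ m'' y) (hm0 : ∀ y, 0 < y → 0 ≤ m y) (hmM : ∀ y, 0 < y → m y ≤ M) :
    ∫⁻ y in Set.Ioi (0 : ℝ), ENNReal.ofReal (y * m'' y) ≤ ENNReal.ofReal M := by
  have hconv : ConvexOn ℝ (Set.Ioi 0) m := by
    refine convexOn_of_hasDerivWithinAt2_nonneg (convex_Ioi 0)
      (fun y hy => (h1 y hy).continuousAt.continuousWithinAt) (f' := m') (f'' := m'') ?_ ?_ ?_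
    all_goals rw [interior_Ioi]; intro y hy
    · exact (h1 y hy).hasDerivWithinAt
    · exact (h2 y hy).hasDerivWithinAt
    · exact hm'' y hy
  -- A positive slope at `y` would push the convex function above its bound `M` at the point `z`.
  have hneg : ∀ y, 0 < y → m' y ≤ 0 := by
    intro y hy
    by_contra! hpos
    set z := y + (M + 1) / m' y with hz
    have hM : 0 ≤ M := (hm0 y hy).trans (hmM y hy)
    have hzy : y < z := by
      have : 0 < (M + 1) / m' y := by positivity
      linarith
    have h := hconv.le_slope_of_hasDerivAt hy (hy.trans hzy) hzy (h1 y hy)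
    rw [slope_def_field, le_div_iff₀ (by linarith), hz, add_sub_cancel_left,
      mul_div_cancel₀ _ hpos.ne', ← hz] at h
    linarith [hm0 y hy, hmM z (hy.trans hzy)]
  -- The left side is the height at `0` of the tangent at `a`; it is reached as a limit of `η → 0+`,
  -- since `m` is controlled only on the open half-line.
  have htan : ∀ a, 0 < a → m a - a * m' a ≤ M := by
    intro a ha
    have hη : ∀ η ∈ Set.Ioo 0 a, m a - (a - η) * m' a ≤ M := by
      intro η hη
      have h := hconv.slope_le_of_hasDerivAt hη.1 ha hη.2 (h1 a ha)
      rw [slope_def_field, div_le_iff₀ (by linarith [hη.2])] at h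
      linarith [hmM η hη.1]
    have hlim : Filter.Tendsto (fun η : ℝ => m a - (a - η) * m' a) (nhdsWithin 0 (Set.Ioi 0))
        (nhds (m a - (a - 0) * m' a)) :=
      (Continuous.tendsto (by fun_prop) _).mono_left nhdsWithin_le_nhds
    rw [sub_zero] at hlim
    exact le_of_tendsto hlim (Filter.mem_of_superset (Ioo_mem_nhdsGT ha) hη)
  -- With this primitive, the integral over `(a, R]` is `R m'(R) - m(R) + (m(a) - a m'(a))`: the
  -- first two terms are nonpositive and the last is at most `M`.
  have hA : ∀ y, 0 < y → HasDerivAt (fun y => y * m' y - m y) (y * m'' y) y := by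
    intro y hy
    refine (((hasDerivAt_id y).mul (h2 y hy)).sub (h1 y hy)).congr_deriv ?_
    simp
  have hmeas : AEMeasurable (fun y => ENNReal.ofReal (y * m'' y))
      (volume.restrict (Set.Ioi (0 : ℝ))) := by
    refine AEMeasurable.congr (f := fun y => ENNReal.ofReal (y * deriv m' y))
      (measurable_id.mul (measurable_deriv m')).ennreal_ofReal.aemeasurable ?_
    refine (ae_restrict_iff' measurableSet_Ioi).2 (Filter.Eventually.of_forall fun y hy => ?_)
    simp only [(h2 y hy).deriv]
  have hcover := (aecover_Ioi_of_Ioi (μ := (volume : Measure ℝ)) (A := 0)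
    (tendsto_one_div_add_atTop_nhds_zero_nat (𝕜 := ℝ))).inter
    (aecover_Iic (μ := volume.restrict (Set.Ioi (0 : ℝ))) (tendsto_natCast_atTop_atTop (R := ℝ)))
  refine le_of_tendsto' (hcover.lintegral_tendsto_of_countably_generated hmeas) fun k => ?_
  set a : ℝ := 1 / ((k : ℝ) + 1) with ha
  set R : ℝ := (k : ℝ) with hR
  have ha0 : 0 < a := by positivity
  rw [Set.Ioi_inter_Iic, Measure.restrict_restrict measurableSet_Ioc,
    Set.inter_eq_left.2 (show Set.Ioc a R ⊆ Set.Ioi 0 from fun y hy => ha0.trans hy.1)]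
  rcases le_or_gt a R with haR | haR
  · have hint : IntegrableOn (fun y => y * m'' y) (Set.Ioc a R) := by
      refine intervalIntegral.integrableOn_deriv_of_nonneg (g := fun y => y * m' y - m y)
        (fun y hy => (hA y (ha0.trans_le hy.1)).continuousAt.continuousWithinAt)
        (fun y hy => hA y (ha0.trans hy.1)) (fun y hy => ?_)
      exact mul_nonneg (ha0.trans hy.1).le (hm'' y (ha0.trans hy.1))
    rw [← ofReal_integral_eq_lintegral_ofReal hint ((ae_restrict_iff' measurableSet_Ioc).2
      (Filter.Eventually.of_forall fun y hy =>
        mul_nonneg (ha0.trans hy.1).le (hm'' y (ha0.trans hy.1))))]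
    refine ENNReal.ofReal_le_ofReal ?_
    rw [← intervalIntegral.integral_of_le haR,
      intervalIntegral.integral_eq_sub_of_hasDerivAt (f := fun y => y * m' y - m y)
        (fun y hy => ?_) ((intervalIntegrable_iff_integrableOn_Ioc_of_le haR).2 hint)]
    · have h3 := htan a ha0
      have hR0 : 0 < R := ha0.trans_le haR
      have h4 := mul_nonpos_of_nonneg_of_nonpos hR0.le (hneg R hR0)
      have h5 := hm0 R hR0
      linarith
    · rw [Set.uIcc_of_le haR] at hy
      exact hA y (ha0.trans_le hy.1)
  · rw [Set.Ioc_eq_empty_of_le haR.le]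
    simp

end ConvexOneDim

/-! ### Tangent planes of convex functions. -/

section Tangent

variable {V : Type*} [NormedAddCommGroup V] [NormedSpace ℝ V]

/-- A convex differentiable function lies above its tangent planes. -/
theorem ConvexOn.add_fderiv_le {F : V → ℝ} (hF : ConvexOn ℝ Set.univ F) {X : V}
    (hd : DifferentiableAt ℝ F X) (Y : V) : F X + fderiv ℝ F X (Y - X) ≤ F Y := by
  have hg : ConvexOn ℝ Set.univ (F ∘ AffineMap.lineMap (k := ℝ) X Y) := hF.comp_affineMap _
  have hl : HasDerivAt (AffineMap.lineMap X Y : ℝ → V) (Y - X) 0 := AffineMap.hasDerivAt_lineMap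
  have hd' : HasFDerivAt F (fderiv ℝ F X) (AffineMap.lineMap X Y (0 : ℝ)) := by
    simpa using hd.hasFDerivAt
  have h := hg.le_slope_of_hasDerivAt (Set.mem_univ 0) (Set.mem_univ 1) one_pos
    (hd'.comp_hasDerivAt 0 hl)
  simp [slope_def_field] at h
  simp only [map_sub]
  linarith

end Tangent

/-! ### Differentiating Poisson extensions; Jensen's inequality. -/

section PoissonExtension

variable {n : ℕ} {V : Type*} [NormedAddCommGroup V] [NormedSpace ℝ V]

theorem integrable_kernel_smul {k : EuclideanSpace ℝ (Fin n) → ℝ} (hk : Continuous k)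
    {w : EuclideanSpace ℝ (Fin n) → V} (hw : Continuous w) (hw' : HasCompactSupport w)
    (x : EuclideanSpace ℝ (Fin n)) : Integrable fun z => k (x - z) • w z :=
  ((hk.comp (by fun_prop)).smul hw).integrable_of_hasCompactSupport hw'.smul_left

theorem continuous_kernel_convolution {k : EuclideanSpace ℝ (Fin n) → ℝ} (hk : Continuous k)
    {w : EuclideanSpace ℝ (Fin n) → V} (hw : Continuous w) (hw' : HasCompactSupport w) :
    Continuous (k ⋆[ContinuousLinearMap.lsmul ℝ ℝ, volume] w) :=
  hw'.continuous_convolution_right _ hk.locallyIntegrable hw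

theorem norm_kernel_convolution_le {k G : EuclideanSpace ℝ (Fin n) → ℝ} (hG : Continuous G)
    {C : ℝ} (hkG : ∀ x, |k x| ≤ C * G x)
    {w : EuclideanSpace ℝ (Fin n) → V} (hw : Continuous w) (hw' : HasCompactSupport w)
    (x : EuclideanSpace ℝ (Fin n)) :
    ‖(k ⋆[ContinuousLinearMap.lsmul ℝ ℝ, volume] w) x‖ ≤
      C * (G ⋆[ContinuousLinearMap.lsmul ℝ ℝ, volume] fun z => ‖w z‖) x := by
  rw [convolution_lsmul_swap, convolution_lsmul_swap, ← integral_const_mul]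
  refine norm_integral_le_of_norm_le
    ((integrable_kernel_smul hG hw.norm hw'.norm x).const_mul C)
    (Filter.Eventually.of_forall fun z => ?_)
  rw [norm_smul, smul_eq_mul, ← mul_assoc]
  exact mul_le_mul_of_nonneg_right (hkG _) (norm_nonneg _)

/-- Differentiation of a convolution with respect to a direction of the upper half-space. -/
theorem hasDerivAt_kernel_convolution {k k' : ℝ → EuclideanSpace ℝ (Fin n) → ℝ}
    {d : EuclideanSpace ℝ (Fin n) × ℝ} (hd : ‖d.1‖ ^ 2 + d.2 ^ 2 = 1)
    (hk : ∀ y, 0 < y → Continuous (k y)) (hk' : ∀ y, 0 < y → Continuous (k' y))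
    (hder : ∀ (x : EuclideanSpace ℝ (Fin n)) (y t : ℝ), 0 < y + t * d.2 →
      HasDerivAt (fun t : ℝ => k (y + t * d.2) (x + t • d.1)) (k' (y + t * d.2) (x + t • d.1)) t)
    (hbd : ∀ y₀ Y : ℝ, 0 < y₀ → ∃ C : ℝ, ∀ y ∈ Set.Icc y₀ Y, ∀ x, |k' y x| ≤ C)
    {w : EuclideanSpace ℝ (Fin n) → V} (hw : Continuous w) (hw' : HasCompactSupport w)
    (x : EuclideanSpace ℝ (Fin n)) {y : ℝ} (hy : 0 < y) :
    HasDerivAt (fun t : ℝ =>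
        (k (y + t * d.2) ⋆[ContinuousLinearMap.lsmul ℝ ℝ, volume] w) (x + t • d.1))
      ((k' y ⋆[ContinuousLinearMap.lsmul ℝ ℝ, volume] w) x) 0 := by
  -- For `|t| < y / 2` and a unit direction, the heights `y + t * d.2` stay in `[y/2, 2y]`, away
  -- from the singular boundary.
  obtain ⟨C, hC⟩ := hbd (y / 2) (2 * y) (by positivity)
  have hτ : |d.2| ≤ 1 := by
    rw [← sq_le_one_iff_abs_le_one]; nlinarith [sq_nonneg ‖d.1‖]
  have hball : ∀ t ∈ Metric.ball (0 : ℝ) (y / 2), y + t * d.2 ∈ Set.Icc (y / 2) (2 * y) := by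
    intro t ht
    rw [mem_ball_zero_iff, Real.norm_eq_abs] at ht
    have h1 : |t * d.2| ≤ y / 2 := by
      rw [abs_mul]
      calc |t| * |d.2| ≤ |t| * 1 := by gcongr
        _ ≤ y / 2 := by linarith
    rw [abs_le] at h1
    exact ⟨by linarith, by linarith⟩
  have hpos : ∀ t ∈ Metric.ball (0 : ℝ) (y / 2), 0 < y + t * d.2 := fun t ht =>
    lt_of_lt_of_le (by positivity) (hball t ht).1
  have hnhds : Metric.ball (0 : ℝ) (y / 2) ∈ nhds (0 : ℝ) := Metric.ball_mem_nhds _ (by positivity)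
  simp only [convolution_lsmul_swap]
  have key := hasDerivAt_integral_of_dominated_loc_of_deriv_le (μ := volume) (𝕜 := ℝ)
    (F := fun t z => k (y + t * d.2) (x + t • d.1 - z) • w z)
    (F' := fun t z => k' (y + t * d.2) (x + t • d.1 - z) • w z) (x₀ := 0)
    (bound := fun z => C * ‖w z‖) hnhds
    (Filter.eventually_of_mem hnhds fun t ht =>
      (integrable_kernel_smul (hk _ (hpos t ht)) hw hw' _).aestronglyMeasurable)
    (integrable_kernel_smul (hk _ (hpos 0 (mem_of_mem_nhds hnhds))) hw hw' _)
    (integrable_kernel_smul (hk' _ (hpos 0 (mem_of_mem_nhds hnhds))) hw hw' _).aestronglyMeasurable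
    (Filter.Eventually.of_forall fun z t ht => by
      rw [norm_smul]
      exact mul_le_mul_of_nonneg_right (hC _ (hball t ht) _) (norm_nonneg _))
    ((hw.norm.integrable_of_hasCompactSupport hw'.norm).const_mul C)
    (Filter.Eventually.of_forall fun z t ht => by
      have h := (hder (x - z) y t (hpos t ht)).smul_const (w z)
      simp only [sub_add_eq_add_sub] at h
      exact h)
  simpa using key.2

variable {d : EuclideanSpace ℝ (Fin n) × ℝ} {w : EuclideanSpace ℝ (Fin n) → V}

theorem hasDerivAt_poisson_convolution (hd : ‖d.1‖ ^ 2 + d.2 ^ 2 = 1) (hw : Continuous w)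
    (hw' : HasCompactSupport w) (x : EuclideanSpace ℝ (Fin n)) {y : ℝ} (hy : 0 < y) :
    HasDerivAt (fun t : ℝ => (halfSpacePoissonKernel n (y + t * d.2)
        ⋆[ContinuousLinearMap.lsmul ℝ ℝ, volume] w) (x + t • d.1))
      ((poissonKernelDeriv n d y ⋆[ContinuousLinearMap.lsmul ℝ ℝ, volume] w) x) 0 := by
  refine hasDerivAt_kernel_convolution hd (fun y hy => continuous_halfSpacePoissonKernel hy)
    (fun y hy => continuous_poissonKernelDeriv hy)
    (fun x y t ht => hasDerivAt_halfSpacePoissonKernel hd x ht) (fun y₀ Y hy₀ => ?_) hw hw' x hy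
  obtain ⟨C, hC0, hC⟩ := exists_poissonKernel_bound hd (Y := Y) hy₀
  exact ⟨C, fun y hy x => (hC y hy x).2.1.trans
    (mul_le_of_le_one_right hC0 (poissonMajorant_le_one x))⟩

theorem hasDerivAt_poissonDeriv_convolution (hd : ‖d.1‖ ^ 2 + d.2 ^ 2 = 1) (hw : Continuous w)
    (hw' : HasCompactSupport w) (x : EuclideanSpace ℝ (Fin n)) {y : ℝ} (hy : 0 < y) :
    HasDerivAt (fun t : ℝ => (poissonKernelDeriv n d (y + t * d.2)
        ⋆[ContinuousLinearMap.lsmul ℝ ℝ, volume] w) (x + t • d.1))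
      ((poissonKernelDeriv₂ n d y ⋆[ContinuousLinearMap.lsmul ℝ ℝ, volume] w) x) 0 := by
  refine hasDerivAt_kernel_convolution hd (fun y hy => continuous_poissonKernelDeriv hy)
    (fun y hy => continuous_poissonKernelDeriv₂ hy)
    (fun x y t ht => hasDerivAt_poissonKernelDeriv hd x ht) (fun y₀ Y hy₀ => ?_) hw hw' x hy
  obtain ⟨C, hC0, hC⟩ := exists_poissonKernel_bound hd (Y := Y) hy₀
  exact ⟨C, fun y hy x => (hC y hy x).2.2.trans
    (mul_le_of_le_one_right hC0 (poissonMajorant_le_one x))⟩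

theorem sum_poissonDeriv₂_convolution (hw : Continuous w) (hw' : HasCompactSupport w)
    (x : EuclideanSpace ℝ (Fin n)) {y : ℝ} (hy : 0 < y) :
    ∑ j, (poissonKernelDeriv₂ n (halfSpaceDir n j) y
      ⋆[ContinuousLinearMap.lsmul ℝ ℝ, volume] w) x = 0 := by
  simp only [convolution_lsmul_swap]
  rw [← integral_finsetSum _ fun j _ =>
    integrable_kernel_smul (continuous_poissonKernelDeriv₂ hy) hw hw' x]
  simp only [← Finset.sum_smul, sum_poissonKernelDeriv₂ hy, zero_smul, integral_zero]

/-- Jensen's inequality for the Poisson kernel. -/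
theorem convex_comp_poisson_convolution_le [CompleteSpace V] {F : V → ℝ} (hF : Differentiable ℝ F)
    (hconv : ConvexOn ℝ Set.univ F) (hF0 : F 0 = 0) (hw : Continuous w)
    (hw' : HasCompactSupport w) (x : EuclideanSpace ℝ (Fin n)) {y : ℝ} (hy : 0 < y) :
    F ((halfSpacePoissonKernel n y ⋆[ContinuousLinearMap.lsmul ℝ ℝ, volume] w) x) ≤
      (halfSpacePoissonKernel n y ⋆[ContinuousLinearMap.lsmul ℝ ℝ, volume] fun z => F (w z)) x := by
  set X := (halfSpacePoissonKernel n y ⋆[ContinuousLinearMap.lsmul ℝ ℝ, volume] w) x with hX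
  set P := halfSpacePoissonKernel n y with hP
  have hPc : Continuous P := continuous_halfSpacePoissonKernel hy
  have hPi : Integrable fun z => P (x - z) :=
    (integrable_halfSpacePoissonKernel hy).comp_sub_left x
  have hP1 : ∫ z, P (x - z) = 1 := by
    rw [integral_sub_left_eq_self P volume x]; exact integral_halfSpacePoissonKernel hy
  have hFw : HasCompactSupport fun z => F (w z) := hw'.comp_left hF0
  have hPw := integrable_kernel_smul hPc hw hw' x
  rw [convolution_lsmul_swap]
  have hXe : X = ∫ z, P (x - z) • w z := by rw [hX, convolution_lsmul_swap]
  -- The tangent plane of `F` at the average `X` is integrated against the kernel, which has mass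
  -- one.
  calc F X = (F X - fderiv ℝ F X X) * (∫ z, P (x - z)) + fderiv ℝ F X (∫ z, P (x - z) • w z) := by
        rw [hP1, ← hXe]; ring
    _ = ∫ z, ((F X - fderiv ℝ F X X) * P (x - z) + fderiv ℝ F X (P (x - z) • w z)) := by
        rw [integral_add (hPi.const_mul _) ((fderiv ℝ F X).integrable_comp hPw),
          integral_const_mul, ContinuousLinearMap.integral_comp_comm _ hPw]
    _ ≤ ∫ z, P (x - z) • F (w z) := by
        refine integral_mono ((hPi.const_mul _).add ((fderiv ℝ F X).integrable_comp hPw))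
          (integrable_kernel_smul hPc (hF.continuous.comp hw) hFw x) fun z => ?_
        have h1 := hconv.add_fderiv_le (hF X) (w z)
        have h2 := mul_le_mul_of_nonneg_left h1 (halfSpacePoissonKernel_nonneg hy (x - z))
        rw [map_sub] at h2
        simp only [map_smul, smul_eq_mul]
        linarith

end PoissonExtension

/-! ### An integrable majorant for the extensions. -/

section Majorant

variable {n : ℕ} {V : Type*} [NormedAddCommGroup V] {w : EuclideanSpace ℝ (Fin n) → V}

/-- An integrable function dominating the derivatives of the Poisson extension of `w`. -/
noncomputable def poissonMajorantExt (w : EuclideanSpace ℝ (Fin n) → V) :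
    EuclideanSpace ℝ (Fin n) → ℝ :=
  poissonMajorant n ⋆[ContinuousLinearMap.lsmul ℝ ℝ, volume] fun z => ‖w z‖

theorem integrable_poissonMajorantExt (hw : Continuous w) (hw' : HasCompactSupport w) :
    Integrable (poissonMajorantExt w) :=
  integrable_poissonMajorant.integrable_convolution _
    (hw.norm.integrable_of_hasCompactSupport hw'.norm)

theorem poissonMajorantExt_nonneg (x : EuclideanSpace ℝ (Fin n)) : 0 ≤ poissonMajorantExt w x := by
  rw [poissonMajorantExt, convolution_lsmul_swap]
  exact integral_nonneg fun z => mul_nonneg (poissonMajorant_nonneg _) (norm_nonneg _)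

theorem poissonMajorantExt_le (hw : Continuous w) (hw' : HasCompactSupport w)
    (x : EuclideanSpace ℝ (Fin n)) : poissonMajorantExt w x ≤ ∫ z, ‖w z‖ := by
  rw [poissonMajorantExt, convolution_lsmul_swap]
  refine integral_mono (integrable_kernel_smul continuous_poissonMajorant hw.norm hw'.norm x)
    (hw.norm.integrable_of_hasCompactSupport hw'.norm) fun z => ?_
  exact mul_le_of_le_one_left (norm_nonneg _) (poissonMajorant_le_one _)

end Majorant

/-! ### Chain rules along curves. -/

section Curves

variable {V : Type*} [NormedAddCommGroup V] [NormedSpace ℝ V] {F : V → ℝ} {γ γ₁ : ℝ → V} {v v₁ : V}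

theorem hasDerivAt_comp_curve (hF : ContDiff ℝ 2 F) {t : ℝ} (hγ : HasDerivAt γ v t) :
    HasDerivAt (fun t => F (γ t)) (fderiv ℝ F (γ t) v) t :=
  ((hF.differentiable (by norm_num)) (γ t)).hasFDerivAt.comp_hasDerivAt t hγ

theorem hasDerivAt_fderiv_comp_curve (hF : ContDiff ℝ 2 F) {t : ℝ} (hγ : HasDerivAt γ v t)
    (hγ₁ : HasDerivAt γ₁ v₁ t) :
    HasDerivAt (fun t => fderiv ℝ F (γ t) (γ₁ t))
      (fderiv ℝ (fderiv ℝ F) (γ t) v (γ₁ t) + fderiv ℝ F (γ t) v₁) t := by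
  have hF' : ContDiff ℝ 1 (fderiv ℝ F) := hF.fderiv_right (by norm_num)
  have h := ((hF'.differentiable (by norm_num)) (γ t)).hasFDerivAt.comp_hasDerivAt t hγ
  exact h.clm_apply hγ₁

theorem hasDerivAt_of_comp_const_add {f : ℝ → V} {f' : V} {y : ℝ}
    (h : HasDerivAt (fun t => f (y + t)) f' 0) : HasDerivAt f f' y := by
  have h' := HasDerivAt.comp_const_add (-y) y (by rwa [neg_add_cancel] :
    HasDerivAt (fun t => f (y + t)) f' (-y + y))
  simpa using h'

end Curves

/-! ### Green's formula for `F ∘ u`. -/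

section Green

variable {n : ℕ} {V : Type*} [NormedAddCommGroup V] [NormedSpace ℝ V]

/-- The derivative of `F ∘ u` in the direction `d`, for `u` the Poisson extension of `w`. -/
noncomputable def compPoissonDeriv (F : V → ℝ) (w : EuclideanSpace ℝ (Fin n) → V)
    (d : EuclideanSpace ℝ (Fin n) × ℝ) (y : ℝ) (x : EuclideanSpace ℝ (Fin n)) : ℝ :=
  fderiv ℝ F ((halfSpacePoissonKernel n y ⋆[ContinuousLinearMap.lsmul ℝ ℝ, volume] w) x)
    ((poissonKernelDeriv n d y ⋆[ContinuousLinearMap.lsmul ℝ ℝ, volume] w) x)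

/-- The part of the second derivative of `F ∘ u` in the direction `d` coming from the Hessian of
`F`, for `u` the Poisson extension of `w`. -/
noncomputable def compPoissonHess (F : V → ℝ) (w : EuclideanSpace ℝ (Fin n) → V)
    (d : EuclideanSpace ℝ (Fin n) × ℝ) (y : ℝ) (x : EuclideanSpace ℝ (Fin n)) : ℝ :=
  fderiv ℝ (fderiv ℝ F)
    ((halfSpacePoissonKernel n y ⋆[ContinuousLinearMap.lsmul ℝ ℝ, volume] w) x)
    ((poissonKernelDeriv n d y ⋆[ContinuousLinearMap.lsmul ℝ ℝ, volume] w) x)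
    ((poissonKernelDeriv n d y ⋆[ContinuousLinearMap.lsmul ℝ ℝ, volume] w) x)

/-- The second derivative of `F ∘ u` in the unit direction `d`, for `u` the Poisson extension
of `w`. -/
noncomputable def compPoissonDeriv₂ (F : V → ℝ) (w : EuclideanSpace ℝ (Fin n) → V)
    (d : EuclideanSpace ℝ (Fin n) × ℝ) (y : ℝ) (x : EuclideanSpace ℝ (Fin n)) : ℝ :=
  compPoissonHess F w d y x +
  fderiv ℝ F ((halfSpacePoissonKernel n y ⋆[ContinuousLinearMap.lsmul ℝ ℝ, volume] w) x)
    ((poissonKernelDeriv₂ n d y ⋆[ContinuousLinearMap.lsmul ℝ ℝ, volume] w) x)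

variable {F : V → ℝ} {w : EuclideanSpace ℝ (Fin n) → V} {d : EuclideanSpace ℝ (Fin n) × ℝ}

theorem hasDerivAt_comp_poisson (hF : ContDiff ℝ 2 F) (hd : ‖d.1‖ ^ 2 + d.2 ^ 2 = 1)
    (hw : Continuous w) (hw' : HasCompactSupport w) (x : EuclideanSpace ℝ (Fin n)) {y : ℝ}
    (hy : 0 < y) :
    HasDerivAt (fun t : ℝ => F ((halfSpacePoissonKernel n (y + t * d.2)
        ⋆[ContinuousLinearMap.lsmul ℝ ℝ, volume] w) (x + t • d.1)))
      (compPoissonDeriv F w d y x) 0 := by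
  have h := hasDerivAt_comp_curve hF (hasDerivAt_poisson_convolution hd hw hw' x hy)
  simp only [zero_mul, zero_smul, add_zero] at h
  exact h

theorem hasDerivAt_compPoissonDeriv (hF : ContDiff ℝ 2 F) (hd : ‖d.1‖ ^ 2 + d.2 ^ 2 = 1)
    (hw : Continuous w) (hw' : HasCompactSupport w) (x : EuclideanSpace ℝ (Fin n)) {y : ℝ}
    (hy : 0 < y) :
    HasDerivAt (fun t : ℝ => compPoissonDeriv F w d (y + t * d.2) (x + t • d.1))
      (compPoissonDeriv₂ F w d y x) 0 := by
  have h := hasDerivAt_fderiv_comp_curve hF (hasDerivAt_poisson_convolution hd hw hw' x hy)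
    (hasDerivAt_poissonDeriv_convolution hd hw hw' x hy)
  simp only [zero_mul, zero_smul, add_zero] at h
  exact h

theorem continuous_compPoissonDeriv (hF : ContDiff ℝ 2 F)
    (hw : Continuous w) (hw' : HasCompactSupport w) {y : ℝ} (hy : 0 < y) :
    Continuous (compPoissonDeriv F w d y) :=
  ((hF.continuous_fderiv (by norm_num)).comp
    (continuous_kernel_convolution (continuous_halfSpacePoissonKernel hy) hw hw')).clm_apply
    (continuous_kernel_convolution (continuous_poissonKernelDeriv hy) hw hw')

theorem continuous_compPoissonDeriv₂ (hF : ContDiff ℝ 2 F)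
    (hw : Continuous w) (hw' : HasCompactSupport w) {y : ℝ} (hy : 0 < y) :
    Continuous (compPoissonDeriv₂ F w d y) := by
  have hF' : ContDiff ℝ 1 (fderiv ℝ F) := hF.fderiv_right (by norm_num)
  have hu := continuous_kernel_convolution (continuous_halfSpacePoissonKernel hy) hw hw'
  have hu1 := continuous_kernel_convolution (continuous_poissonKernelDeriv (d := d) hy) hw hw'
  have hu2 := continuous_kernel_convolution (continuous_poissonKernelDeriv₂ (d := d) hy) hw hw'
  exact ((((hF'.continuous_fderiv (by norm_num)).comp hu).clm_apply hu1).clm_apply hu1).add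
    (((hF.continuous_fderiv (by norm_num)).comp hu).clm_apply hu2)

variable [FiniteDimensional ℝ V]

/-- The extension takes values in a fixed ball, compact by finite dimension, on which two
derivatives of `F` are bounded. In the quadratic Hessian term one factor is bounded uniformly by `C
* W` and the other by the integrable majorant. -/
theorem exists_compPoisson_bound (hF : ContDiff ℝ 2 F) (hd : ‖d.1‖ ^ 2 + d.2 ^ 2 = 1)
    (hw : Continuous w) (hw' : HasCompactSupport w) {y₀ Y : ℝ} (hy₀ : 0 < y₀) :
    ∃ C : ℝ, ∀ y ∈ Set.Icc y₀ Y, ∀ x,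
      |compPoissonDeriv F w d y x| ≤ C * poissonMajorantExt w x ∧
      |compPoissonDeriv₂ F w d y x| ≤ C * poissonMajorantExt w x := by
  obtain ⟨C, hC0, hC⟩ := exists_poissonKernel_bound hd (Y := Y) hy₀
  set W := ∫ z, ‖w z‖ with hW
  have hW0 : 0 ≤ W := integral_nonneg fun z => norm_nonneg _
  have hF' : ContDiff ℝ 1 (fderiv ℝ F) := hF.fderiv_right (by norm_num)
  have hK : IsCompact (Metric.closedBall (0 : V) (C * W)) := isCompact_closedBall _ _
  obtain ⟨L₁, hL₁⟩ := hK.exists_bound_of_continuousOn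
    (hF.continuous_fderiv (by norm_num)).continuousOn
  obtain ⟨L₂, hL₂⟩ := hK.exists_bound_of_continuousOn
    (hF'.continuous_fderiv (by norm_num)).continuousOn
  have h0 : (0 : V) ∈ Metric.closedBall (0 : V) (C * W) :=
    Metric.mem_closedBall_self (by positivity)
  have hL₁0 : 0 ≤ L₁ := (norm_nonneg _).trans (hL₁ 0 h0)
  have hL₂0 : 0 ≤ L₂ := (norm_nonneg _).trans (hL₂ 0 h0)
  refine ⟨L₁ * C + L₂ * (C * (C * W)), fun y hy x => ?_⟩
  set Φ := poissonMajorantExt w x with hΦ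
  have hΦ0 : 0 ≤ Φ := poissonMajorantExt_nonneg x
  have hΦW : Φ ≤ W := poissonMajorantExt_le hw hw' x
  have hu := norm_kernel_convolution_le continuous_poissonMajorant (fun x => (hC y hy x).1) hw hw' x
  have hu1 := norm_kernel_convolution_le continuous_poissonMajorant (fun x => (hC y hy x).2.1)
    hw hw' x
  have hu2 := norm_kernel_convolution_le continuous_poissonMajorant (fun x => (hC y hy x).2.2)
    hw hw' x
  rw [← poissonMajorantExt, ← hΦ] at hu hu1 hu2
  have humem : (halfSpacePoissonKernel n y ⋆[ContinuousLinearMap.lsmul ℝ ℝ, volume] w) x ∈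
      Metric.closedBall (0 : V) (C * W) := by
    rw [mem_closedBall_zero_iff]
    exact hu.trans (by gcongr)
  have b1 : ∀ v : V, ‖v‖ ≤ C * Φ → |fderiv ℝ F ((halfSpacePoissonKernel n y
      ⋆[ContinuousLinearMap.lsmul ℝ ℝ, volume] w) x) v| ≤ L₁ * C * Φ := by
    intro v hv
    rw [← Real.norm_eq_abs, mul_assoc]
    refine (ContinuousLinearMap.le_opNorm _ _).trans ?_
    gcongr
    exact hL₁ _ humem
  have b2 : |compPoissonHess F w d y x| ≤ L₂ * (C * (C * W)) * Φ := by
    rw [← Real.norm_eq_abs]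
    refine (ContinuousLinearMap.le_opNorm₂ _ _ _).trans ?_
    calc _ ≤ L₂ * (C * W) * (C * Φ) := by
          gcongr
          · exact hL₂ _ humem
          · exact hu1.trans (by gcongr)
      _ = _ := by ring
  have e1 : 0 ≤ L₁ * C * Φ := by positivity
  have e2 : 0 ≤ L₂ * (C * (C * W)) * Φ := by positivity
  refine ⟨?_, ?_⟩
  · have : |compPoissonDeriv F w d y x| ≤ L₁ * C * Φ := b1 _ hu1
    linarith
  · have := (abs_add_le _ _).trans (add_le_add b2 (b1 _ hu2))
    rw [compPoissonDeriv₂]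
    linarith

theorem integrable_compPoissonDeriv (hF : ContDiff ℝ 2 F) (hd : ‖d.1‖ ^ 2 + d.2 ^ 2 = 1)
    (hw : Continuous w) (hw' : HasCompactSupport w) {y : ℝ} (hy : 0 < y) :
    Integrable (compPoissonDeriv F w d y) := by
  obtain ⟨C, hC⟩ := exists_compPoisson_bound hF hd hw hw' (Y := y) hy
  exact ((integrable_poissonMajorantExt hw hw').const_mul C).mono'
    (continuous_compPoissonDeriv hF hw hw' hy).aestronglyMeasurable
    (Filter.Eventually.of_forall fun x => (hC y ⟨le_rfl, le_rfl⟩ x).1)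

theorem integrable_compPoissonDeriv₂ (hF : ContDiff ℝ 2 F) (hd : ‖d.1‖ ^ 2 + d.2 ^ 2 = 1)
    (hw : Continuous w) (hw' : HasCompactSupport w) {y : ℝ} (hy : 0 < y) :
    Integrable (compPoissonDeriv₂ F w d y) := by
  obtain ⟨C, hC⟩ := exists_compPoisson_bound hF hd hw hw' (Y := y) hy
  exact ((integrable_poissonMajorantExt hw hw').const_mul C).mono'
    (continuous_compPoissonDeriv₂ hF hw hw' hy).aestronglyMeasurable
    (Filter.Eventually.of_forall fun x => (hC y ⟨le_rfl, le_rfl⟩ x).2)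

theorem integral_compPoissonDeriv₂_horizontal (hF : ContDiff ℝ 2 F)
    (hd : ‖d.1‖ ^ 2 + d.2 ^ 2 = 1) (hd2 : d.2 = 0)
    (hw : Continuous w) (hw' : HasCompactSupport w) {y : ℝ} (hy : 0 < y) :
    ∫ x, compPoissonDeriv₂ F w d y x = 0 := by
  -- Integration by parts against the constant function `1`.
  have h := integral_bilinear_hasLineDerivAt_right_eq_neg_left_of_integrable (μ := volume)
    (f := fun _ : EuclideanSpace ℝ (Fin n) => (1 : ℝ)) (f' := fun _ => 0)
    (g := compPoissonDeriv F w d y) (g' := compPoissonDeriv₂ F w d y) (v := d.1)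
    (B := ContinuousLinearMap.mul ℝ ℝ) (by simp)
    (by simpa using integrable_compPoissonDeriv₂ hF hd hw hw' hy)
    (by simpa using integrable_compPoissonDeriv hF hd hw hw' hy)
    (fun x _ => hasDerivAt_const (0 : ℝ) (1 : ℝ))
    (fun x _ => by
      have := hasDerivAt_compPoissonDeriv hF hd hw hw' x hy
      simpa [hd2, HasLineDerivAt] using this)
  simpa using h

theorem hasDerivAt_integral_vertical {b b' : ℝ → EuclideanSpace ℝ (Fin n) → ℝ}
    {Φ : EuclideanSpace ℝ (Fin n) → ℝ} (hΦ : Integrable Φ)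
    (hbi : ∀ y, 0 < y → Integrable (b y))
    (hb' : ∀ y, 0 < y → Continuous (b' y))
    (hder : ∀ y, 0 < y → ∀ x, HasDerivAt (fun t => b t x) (b' y x) y)
    (hbd : ∀ y₀ Y : ℝ, 0 < y₀ → ∃ C : ℝ, ∀ y ∈ Set.Icc y₀ Y, ∀ x, |b' y x| ≤ C * Φ x)
    {y : ℝ} (hy : 0 < y) :
    HasDerivAt (fun y => ∫ x, b y x) (∫ x, b' y x) y := by
  obtain ⟨C, hC⟩ := hbd (y / 2) (2 * y) (by positivity)
  have hnhds : Set.Icc (y / 2) (2 * y) ∈ nhds y := Icc_mem_nhds (by linarith) (by linarith)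
  have hpos : ∀ t ∈ Set.Icc (y / 2) (2 * y), 0 < t := fun t ht =>
    lt_of_lt_of_le (by positivity) ht.1
  exact (hasDerivAt_integral_of_dominated_loc_of_deriv_le (μ := volume) (𝕜 := ℝ)
    (F := b) (F' := b') (bound := fun x => C * Φ x) hnhds
    (Filter.eventually_of_mem hnhds fun t ht => (hbi t (hpos t ht)).aestronglyMeasurable)
    (hbi y hy) (hb' y hy).aestronglyMeasurable
    (Filter.Eventually.of_forall fun x t ht => hC t ht x) (hΦ.const_mul C)
    (Filter.Eventually.of_forall fun x t ht => hder t (hpos t ht) x)).2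

/-- Green's formula for `F ∘ u`, with `F` convex and `u` the Poisson extension of `w`. -/
theorem lintegral_compPoissonHess_le (hF : ContDiff ℝ 2 F) (hconv : ConvexOn ℝ Set.univ F)
    (hF0 : F 0 = 0) (hFnn : ∀ X, 0 ≤ F X) (hHess : ∀ X K, 0 ≤ fderiv ℝ (fderiv ℝ F) X K K)
    (hw : Continuous w) (hw' : HasCompactSupport w) :
    ∫⁻ y in Set.Ioi (0 : ℝ), ∫⁻ x, ENNReal.ofReal
        (y * ∑ j, compPoissonHess F w (halfSpaceDir n j) y x) ≤
      ENNReal.ofReal (∫ z, F (w z)) := by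
  have hdiff := hF.differentiable (by norm_num)
  have hFw : Continuous fun z => F (w z) := hF.continuous.comp hw
  have hFw' : HasCompactSupport fun z => F (w z) := hw'.comp_left hF0
  have hFwi := hFw.integrable_of_hasCompactSupport hFw' (μ := volume)
  have hunit := halfSpaceDir_unit (n := n)
  have hd0 : halfSpaceDir n 0 = (0, 1) := rfl
  have hPFi : ∀ y, 0 < y → Integrable (halfSpacePoissonKernel n y
      ⋆[ContinuousLinearMap.lsmul ℝ ℝ, volume] fun z => F (w z)) := fun y hy =>
    (integrable_halfSpacePoissonKernel hy).integrable_convolution _ hFwi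
  have hbi : ∀ y, 0 < y → Integrable fun x => F ((halfSpacePoissonKernel n y
      ⋆[ContinuousLinearMap.lsmul ℝ ℝ, volume] w) x) := by
    intro y hy
    refine (hPFi y hy).mono' (hF.continuous.comp (continuous_kernel_convolution
      (continuous_halfSpacePoissonKernel hy) hw hw')).aestronglyMeasurable
      (Filter.Eventually.of_forall fun x => ?_)
    rw [Real.norm_of_nonneg (hFnn _)]
    exact convex_comp_poisson_convolution_le hdiff hconv hF0 hw hw' x hy
  have hm1 : ∀ y, 0 < y → HasDerivAt (fun y => ∫ x, F ((halfSpacePoissonKernel n y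
      ⋆[ContinuousLinearMap.lsmul ℝ ℝ, volume] w) x))
      (∫ x, compPoissonDeriv F w (halfSpaceDir n 0) y x) y := by
    intro y hy
    refine hasDerivAt_integral_vertical (integrable_poissonMajorantExt hw hw') hbi
      (fun y hy => continuous_compPoissonDeriv hF hw hw' hy) (fun y hy x => ?_)
      (fun y₀ Y hy₀ => ?_) hy
    · have h := hasDerivAt_comp_poisson hF (hunit 0) hw hw' x hy
      simp only [hd0, mul_one, smul_zero, add_zero] at h
      exact hasDerivAt_of_comp_const_add (f := fun t => F ((halfSpacePoissonKernel n t
        ⋆[ContinuousLinearMap.lsmul ℝ ℝ, volume] w) x)) h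
    · obtain ⟨C, hC⟩ := exists_compPoisson_bound hF (hunit 0) hw hw' (Y := Y) hy₀
      exact ⟨C, fun y hy x => (hC y hy x).1⟩
  have hm2 : ∀ y, 0 < y → HasDerivAt (fun y => ∫ x, compPoissonDeriv F w (halfSpaceDir n 0) y x)
      (∫ x, compPoissonDeriv₂ F w (halfSpaceDir n 0) y x) y := by
    intro y hy
    refine hasDerivAt_integral_vertical (integrable_poissonMajorantExt hw hw')
      (fun y hy => integrable_compPoissonDeriv hF (hunit 0) hw hw' hy)
      (fun y hy => continuous_compPoissonDeriv₂ hF hw hw' hy) (fun y hy x => ?_)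
      (fun y₀ Y hy₀ => ?_) hy
    · have h := hasDerivAt_compPoissonDeriv hF (hunit 0) hw hw' x hy
      simp only [hd0, mul_one, smul_zero, add_zero] at h
      exact hasDerivAt_of_comp_const_add (f := fun t => compPoissonDeriv F w (0, 1) t x) h
    · obtain ⟨C, hC⟩ := exists_compPoisson_bound hF (hunit 0) hw hw' (Y := Y) hy₀
      exact ⟨C, fun y hy x => (hC y hy x).2⟩
  -- The terms carrying the first derivative of `F` add up to `fderiv F` applied to the Laplacian of
  -- `u`, which is zero.
  have hsumeq : ∀ y, 0 < y → ∀ x, ∑ j, compPoissonHess F w (halfSpaceDir n j) y x =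
      ∑ j, compPoissonDeriv₂ F w (halfSpaceDir n j) y x := by
    intro y hy x
    simp only [compPoissonDeriv₂, Finset.sum_add_distrib]
    rw [← map_sum, sum_poissonDeriv₂_convolution hw hw' x hy, map_zero, add_zero]
  have hsumi : ∀ y, 0 < y → Integrable fun x => ∑ j, compPoissonHess F w (halfSpaceDir n j) y x := by
    intro y hy
    simp only [hsumeq y hy]
    exact integrable_finsetSum _ fun j _ => integrable_compPoissonDeriv₂ hF (hunit j) hw hw' hy
  have hsum : ∀ y, 0 < y → ∫ x, ∑ j, compPoissonHess F w (halfSpaceDir n j) y x =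
      ∫ x, compPoissonDeriv₂ F w (halfSpaceDir n 0) y x := by
    intro y hy
    simp only [hsumeq y hy]
    rw [integral_finsetSum _ fun j _ => integrable_compPoissonDeriv₂ hF (hunit j) hw hw' hy,
      Fin.sum_univ_succ, Finset.sum_eq_zero, add_zero]
    intro i _
    exact integral_compPoissonDeriv₂_horizontal hF (hunit i.succ) rfl hw hw' hy
  have hnn : ∀ y x, 0 ≤ ∑ j, compPoissonHess F w (halfSpaceDir n j) y x := fun y x =>
    Finset.sum_nonneg fun j _ => hHess _ _
  -- Applied to `m(y) = ∫ F(u(x, y)) dx`. Horizontal second derivatives integrate to zero, so `m''`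
  -- is the integral of the full Laplacian; Jensen's inequality and unit mass give `m ≤ ∫ F(w)`.
  have key := lintegral_mul_deriv₂_le (M := ∫ z, F (w z)) hm1 hm2
    (fun y hy => by rw [← hsum y hy]; exact integral_nonneg fun x => hnn y x)
    (fun y hy => integral_nonneg fun x => hFnn _)
    (fun y hy => by
      have h := integral_mono (hbi y hy) (hPFi y hy) fun x =>
        convex_comp_poisson_convolution_le hdiff hconv hF0 hw hw' x hy
      rw [integral_convolution _ (integrable_halfSpacePoissonKernel hy) hFwi,
        integral_halfSpacePoissonKernel hy] at h
      simpa using h)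
  refine le_trans (le_of_eq ?_) key
  refine setLIntegral_congr_fun measurableSet_Ioi fun y hy => ?_
  have hy : 0 < y := hy
  rw [← hsum y hy, ← integral_const_mul, ofReal_integral_eq_lintegral_ofReal
    ((hsumi y hy).const_mul y) (Filter.Eventually.of_forall fun x => mul_nonneg hy.le (hnn y x))]

end Green

/-! ### Gradients of Poisson extensions and the Hessian. -/

section Gradient

variable {𝕜 : Type*} [RCLike 𝕜] {n : ℕ}

theorem norm_fullGradient_poissonExtension {f : EuclideanSpace ℝ (Fin n) → 𝕜} (hf : Continuous f)
    (hf' : HasCompactSupport f) (x : EuclideanSpace ℝ (Fin n)) {y : ℝ} (hy : 0 < y) :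
    ‖fullGradient (poissonExtension f) x y‖ =
      √(∑ j, ‖(poissonKernelDeriv n (halfSpaceDir n j) y
        ⋆[ContinuousLinearMap.lsmul ℝ ℝ, volume] f) x‖ ^ 2) := by
  have h0 : deriv (fun t : ℝ => poissonExtension f x t) y =
      (poissonKernelDeriv n (halfSpaceDir n 0) y
        ⋆[ContinuousLinearMap.lsmul ℝ ℝ, volume] f) x := by
    have h := hasDerivAt_poisson_convolution (halfSpaceDir_unit (n := n) 0) hf hf' x hy
    simp only [show halfSpaceDir n 0 = (0, 1) from rfl, mul_one, smul_zero, add_zero] at h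
    exact (hasDerivAt_of_comp_const_add (f := fun t => poissonExtension f x t) h).deriv
  have hi : ∀ i : Fin n, lineDeriv ℝ (fun z => poissonExtension f z y) x
      (EuclideanSpace.single i 1) = (poissonKernelDeriv n (halfSpaceDir n i.succ) y
        ⋆[ContinuousLinearMap.lsmul ℝ ℝ, volume] f) x := by
    intro i
    have h := hasDerivAt_poisson_convolution (halfSpaceDir_unit (n := n) i.succ) hf hf' x hy
    simp only [show halfSpaceDir n i.succ = (EuclideanSpace.single i 1, 0) from rfl, mul_zero,
      add_zero] at h
    exact h.deriv
  rw [fullGradient, EuclideanSpace.norm_eq, Fin.sum_univ_succ, Fin.sum_univ_succ]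
  simp only [Fin.cons_zero, Fin.cons_succ, h0, hi]

theorem norm_fullGradient_poissonExtension_smul {f : EuclideanSpace ℝ (Fin n) → 𝕜}
    (hf : Continuous f) (hf' : HasCompactSupport f) {c : ℝ} (hc : 0 ≤ c)
    (x : EuclideanSpace ℝ (Fin n)) {y : ℝ} (hy : 0 < y) :
    ‖fullGradient (poissonExtension (c • f)) x y‖ =
      c * ‖fullGradient (poissonExtension f) x y‖ := by
  rw [norm_fullGradient_poissonExtension hf hf' x hy,
    norm_fullGradient_poissonExtension (hf.const_smul c) hf'.smul_left x hy]
  simp only [convolution_smul, Pi.smul_apply, norm_smul, mul_pow, ← Finset.mul_sum]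
  rw [Real.sqrt_mul (by positivity), Real.sqrt_sq (norm_nonneg c), Real.norm_of_nonneg hc]

theorem kernel_convolution_prodMk {k : EuclideanSpace ℝ (Fin n) → ℝ} (hk : Continuous k)
    {f g : EuclideanSpace ℝ (Fin n) → 𝕜} (hf : Continuous f) (hf' : HasCompactSupport f)
    (hg : Continuous g) (hg' : HasCompactSupport g) (x : EuclideanSpace ℝ (Fin n)) :
    (k ⋆[ContinuousLinearMap.lsmul ℝ ℝ, volume] fun z => (f z, g z)) x =
      ((k ⋆[ContinuousLinearMap.lsmul ℝ ℝ, volume] f) x,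
        (k ⋆[ContinuousLinearMap.lsmul ℝ ℝ, volume] g) x) := by
  simp only [convolution_lsmul_swap, Prod.smul_mk]
  exact integral_pair (integrable_kernel_smul hk hf hf' x) (integrable_kernel_smul hk hg hg' x)

/-- A Hessian bounded below by `2 |h| |k|` controls the product of the gradients. -/
theorem two_mul_norm_fullGradient_le {F : 𝕜 × 𝕜 → ℝ}
    (hHess : ∀ X K : 𝕜 × 𝕜, 2 * (‖K.1‖ * ‖K.2‖) ≤ fderiv ℝ (fderiv ℝ F) X K K)
    {f g : EuclideanSpace ℝ (Fin n) → 𝕜} (hf : Continuous f) (hf' : HasCompactSupport f)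
    (hg : Continuous g) (hg' : HasCompactSupport g) (x : EuclideanSpace ℝ (Fin n)) {y : ℝ}
    (hy : 0 < y) :
    2 * (‖fullGradient (poissonExtension f) x y‖ * ‖fullGradient (poissonExtension g) x y‖) ≤
      ∑ j, compPoissonHess F (fun z => (f z, g z)) (halfSpaceDir n j) y x := by
  rw [norm_fullGradient_poissonExtension hf hf' x hy, norm_fullGradient_poissonExtension hg hg' x hy]
  let D := fderiv ℝ (fderiv ℝ F) ((halfSpacePoissonKernel n y
    ⋆[ContinuousLinearMap.lsmul ℝ ℝ, volume] fun z => (f z, g z)) x)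
  have h := two_mul_sqrt_le_sum_bilin
    ((ContinuousLinearMap.coeLM ℝ : (𝕜 × 𝕜 →L[ℝ] ℝ) →ₗ[ℝ] 𝕜 × 𝕜 →ₗ[ℝ] ℝ) ∘ₗ
      (D : 𝕜 × 𝕜 →ₗ[ℝ] 𝕜 × 𝕜 →L[ℝ] ℝ)) (fun K => hHess _ K)
    (fun j => ((poissonKernelDeriv n (halfSpaceDir n j) y
        ⋆[ContinuousLinearMap.lsmul ℝ ℝ, volume] f) x,
        (poissonKernelDeriv n (halfSpaceDir n j) y
        ⋆[ContinuousLinearMap.lsmul ℝ ℝ, volume] g) x))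
  refine h.trans (le_of_eq (Finset.sum_congr rfl fun j _ => ?_))
  rw [compPoissonHess, kernel_convolution_prodMk (continuous_poissonKernelDeriv hy) hf hf' hg hg']
  rfl

end Gradient

/-! ### The bilinear embedding for `1 < p ≤ 2`. -/

section Bilinear

variable {𝕜 : Type*} [RCLike 𝕜] {n : ℕ} {p q : ℝ}

theorem integrable_norm_rpow {f : EuclideanSpace ℝ (Fin n) → 𝕜} (hf : Continuous f)
    (hf' : HasCompactSupport f) {r : ℝ} (hr : 0 < r) : Integrable fun z => ‖f z‖ ^ r :=
  (hf.norm.rpow_const fun _ => Or.inr hr.le).integrable_of_hasCompactSupport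
    (hf'.norm.comp_left (g := fun t : ℝ => t ^ r) (Real.zero_rpow hr.ne'))

/-- The bilinear embedding in additive form, for `1 < p ≤ 2`. -/
theorem bilinear_embedding_add (hpq : p.HolderConjugate q) (hp2 : p ≤ 2)
    {f g : EuclideanSpace ℝ (Fin n) → 𝕜} (hf : Continuous f) (hf' : HasCompactSupport f)
    (hg : Continuous g) (hg' : HasCompactSupport g) :
    2 * ∫⁻ y in Set.Ioi (0 : ℝ), ∫⁻ x : EuclideanSpace ℝ (Fin n),
        ENNReal.ofReal (y * ‖fullGradient (poissonExtension f) x y‖ *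
          ‖fullGradient (poissonExtension g) x y‖) ≤
      ENNReal.ofReal ((1 / (p - 1)) ^ p * (∫ z, ‖f z‖ ^ p) / p + (∫ z, ‖g z‖ ^ q) / q) := by
  set w : EuclideanSpace ℝ (Fin n) → 𝕜 × 𝕜 := fun z => (f z, g z) with hw_def
  have hw : Continuous w := hf.prodMk hg
  have hw' : HasCompactSupport w := by
    refine HasCompactSupport.intro (hf'.isCompact.union hg'.isCompact) fun z hz => ?_
    rw [Set.mem_union, not_or] at hz
    simp [hw_def, image_eq_zero_of_notMem_tsupport hz.1, image_eq_zero_of_notMem_tsupport hz.2]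
  obtain ⟨R, hR⟩ := hw'.exists_bound_of_continuous hw
  set S := tsupport w with hS
  have hSfin : volume S ≠ ⊤ := hw'.isCompact.measure_lt_top.ne
  have hSm : MeasurableSet S := (isClosed_tsupport w).measurableSet
  have hp0 := hpq.pos
  have hq0 := hpq.symm.pos
  have hp1 : 0 < p - 1 := hpq.sub_one_pos
  set A := (1 / (p - 1)) ^ p * (∫ z, ‖f z‖ ^ p) / p + (∫ z, ‖g z‖ ^ q) / q with hA
  have key : ∀ δ : ℝ, 0 < δ → 2 * ∫⁻ y in Set.Ioi (0 : ℝ), ∫⁻ x : EuclideanSpace ℝ (Fin n),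
        ENNReal.ofReal (y * ‖fullGradient (poissonExtension f) x y‖ *
          ‖fullGradient (poissonExtension g) x y‖) ≤
      ENNReal.ofReal (A + 2 * δ * volume.real S) := by
    intro δ hδ
    obtain ⟨F₀, hF₀, hconv, hev, hmid, hap⟩ := exists_contDiff_convex_approx
      (N := fun K : 𝕜 × 𝕜 => 2 * (‖K.1‖ * ‖K.2‖))
      (convexOn_bellmanFun (H := 𝕜) hpq hp2) bellmanFun_neg (bellmanFun_midpoint hpq hp2) R hδ
    set F : 𝕜 × 𝕜 → ℝ := fun X => F₀ X - F₀ 0 with hF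
    have hFc : ContDiff ℝ 2 F := (by exact_mod_cast contDiff_infty.1 hF₀ 2 : ContDiff ℝ 2 F₀).sub contDiff_const
    have hFconv : ConvexOn ℝ Set.univ F :=
      (hconv.add (convexOn_const (-F₀ 0) convex_univ)).congr fun X _ => (sub_eq_add_neg _ _).symm
    have hF0 : F 0 = 0 := sub_self _
    -- The midpoint inequality at the origin together with evenness makes `0` a minimum point of
    -- `F₀`.
    have hFnn : ∀ X, 0 ≤ F X := by
      intro X
      have h := hmid 0 X
      rw [zero_add, zero_sub, hev] at h
      have : 0 ≤ 2 * (‖X.1‖ * ‖X.2‖) := by positivity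
      simp only [hF]
      linarith
    have hHess : ∀ X K : 𝕜 × 𝕜, 2 * (‖K.1‖ * ‖K.2‖) ≤ fderiv ℝ (fderiv ℝ F) X K K := by
      refine le_fderiv_fderiv_of_midpoint (N := fun K : 𝕜 × 𝕜 => 2 * (‖K.1‖ * ‖K.2‖)) hFc ?_ ?_
      · intro t K
        simp only [Prod.smul_fst, Prod.smul_snd, norm_smul]
        rw [← sq_abs t, ← Real.norm_eq_abs]
        ring
      · intro X K
        have := hmid X K
        simp only [hF]
        linarith
    have hgreen := lintegral_compPoissonHess_le hFc hFconv hF0 hFnn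
      (fun X K => le_trans (by positivity) (hHess X K)) hw hw'
    have hFw : ∫ z, F (w z) ≤ A + 2 * δ * volume.real S := by
      -- On the support, one `δ` comes from approximating at `w z` and one from approximating at
      -- `0`, where the Bellman function is nonnegative. Off the support `F (w z) = F 0 = 0`, so the
      -- error is integrated over a set of finite measure.
      have hpt : ∀ z, F (w z) ≤ ((1 / (p - 1)) ^ p * ‖f z‖ ^ p / p + ‖g z‖ ^ q / q) +
          S.indicator (fun _ => 2 * δ) z := by
        intro z
        have hnn : 0 ≤ (1 / (p - 1)) ^ p * ‖f z‖ ^ p / p + ‖g z‖ ^ q / q := by positivity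
        by_cases hz : z ∈ S
        · rw [Set.indicator_of_mem hz]
          have hR0 : 0 ≤ R := (norm_nonneg _).trans (hR z)
          have h1 := (abs_le.1 (hap (w z) (mem_closedBall_zero_iff.2 (hR z)))).2
          have h2 := (abs_le.1 (hap 0 (Metric.mem_closedBall_self hR0))).1
          have h3 := bellmanFun_le hpq hp2 (w z)
          have h4 := le_bellmanFun hpq hp2 (0 : 𝕜 × 𝕜) 0
          have h5 : p - 1 ≠ 0 := hp1.ne'
          simp only [Prod.fst_zero, Prod.snd_zero, inner_zero_left, burkholderFun, norm_zero,
            zero_div, sub_zero, mul_zero] at h4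
          rw [div_eq_mul_one_div ‖(w z).1‖, mul_comm ‖(w z).1‖,
            Real.mul_rpow (by positivity) (norm_nonneg _)] at h3
          simp only [hF]
          linarith
        · rw [Set.indicator_of_notMem hz, image_eq_zero_of_notMem_tsupport hz, hF0, add_zero]
          exact hnn
      have hi1 := ((integrable_norm_rpow hf hf' hp0).const_mul ((1 / (p - 1)) ^ p)).div_const p
      have hi2 := (integrable_norm_rpow hg hg' hq0).div_const q
      have hi3 : Integrable (S.indicator fun _ => 2 * δ) volume :=
        (integrable_indicator_iff hSm).2 (integrableOn_const hSfin)
      have h := integral_mono ((hFc.continuous.comp hw).integrable_of_hasCompactSupport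
        (hw'.comp_left hF0)) ((hi1.add hi2).add hi3) hpt
      refine h.trans (le_of_eq ?_)
      have e := integral_add (hi1.add hi2) hi3
      have e' := integral_add hi1 hi2
      simp only [Pi.add_apply] at e e' ⊢
      rw [e, e', integral_div, integral_div, integral_const_mul, integral_indicator hSm,
        setIntegral_const, smul_eq_mul, hA]
      ring
    rw [← lintegral_const_mul' _ _ (by norm_num)]
    refine le_trans ?_ (hgreen.trans (ENNReal.ofReal_le_ofReal hFw))
    refine setLIntegral_mono' measurableSet_Ioi fun y hy => ?_
    have hy : 0 < y := hy
    rw [← lintegral_const_mul' _ _ (by norm_num)]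
    refine lintegral_mono fun x => ?_
    have h2 : ∀ a : ℝ, 2 * ENNReal.ofReal a = ENNReal.ofReal (2 * a) := fun a => by
      rw [ENNReal.ofReal_mul zero_le_two, ENNReal.ofReal_ofNat]
    rw [h2]
    refine ENNReal.ofReal_le_ofReal ?_
    have := mul_le_mul_of_nonneg_left
      (two_mul_norm_fullGradient_le hHess hf hf' hg hg' x hy) hy.le
    linarith
  have hlim : Filter.Tendsto (fun δ : ℝ => ENNReal.ofReal (A + 2 * δ * volume.real S))
      (nhdsWithin 0 (Set.Ioi 0)) (nhds (ENNReal.ofReal (A + 2 * 0 * volume.real S))) :=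
    ((ENNReal.continuous_ofReal.comp (by fun_prop)).tendsto _).mono_left nhdsWithin_le_nhds
  rw [mul_zero, zero_mul, add_zero] at hlim
  exact ge_of_tendsto hlim (Filter.eventually_of_mem self_mem_nhdsWithin key)

/-- Optimization over a scaling parameter. -/
theorem exists_scaling_eq (hpq : p.HolderConjugate q) {A B : ℝ} (hA : 0 < A) (hB : 0 < B) :
    ∃ c : ℝ, 0 < c ∧ c ^ p * A / p + c⁻¹ ^ q * B / q = A ^ (1 / p) * B ^ (1 / q) := by
  have hp0 := hpq.pos
  have hq0 := hpq.symm.pos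
  have hs := hpq.inv_add_inv_eq_one
  have e1 : 1 / (p * q) * p = 1 / q := by field_simp
  have e2 : -(1 / (p * q)) * q = -(1 / p) := by field_simp
  have eA : A = A ^ (1 / p) * A ^ (1 / q) := by
    rw [← Real.rpow_add hA, one_div, one_div, hs, Real.rpow_one]
  have eB : B = B ^ (1 / p) * B ^ (1 / q) := by
    rw [← Real.rpow_add hB, one_div, one_div, hs, Real.rpow_one]
  have hAp : 0 < A ^ (1 / p) := by positivity
  have hAq : 0 < A ^ (1 / q) := by positivity
  have hBp : 0 < B ^ (1 / p) := by positivity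
  have hBq : 0 < B ^ (1 / q) := by positivity
  -- The optimal `c` balances `c^p A = c^(-q) B`; since `p + q = p q`, this is `c^(p q) = B / A`.
  refine ⟨(B / A) ^ (1 / (p * q)), by positivity, ?_⟩
  have h1 : ((B / A) ^ (1 / (p * q))) ^ p * A = A ^ (1 / p) * B ^ (1 / q) := by
    rw [← Real.rpow_mul (by positivity), e1, Real.div_rpow hB.le hA.le]
    nth_rewrite 2 [eA]
    field_simp
  have h2 : ((B / A) ^ (1 / (p * q)))⁻¹ ^ q * B = A ^ (1 / p) * B ^ (1 / q) := by
    rw [← Real.rpow_neg (by positivity), ← Real.rpow_mul (by positivity), e2,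
      Real.rpow_neg (by positivity), Real.div_rpow hB.le hA.le]
    nth_rewrite 2 [eB]
    field_simp
  rw [h1, h2]
  linear_combination (A ^ (1 / p) * B ^ (1 / q)) * hs

/-- The bilinear embedding for `1 < p ≤ 2`, with the sharp constant `1 / (p - 1)`. -/
theorem bilinear_embedding_of_le_two (hpq : p.HolderConjugate q) (hp2 : p ≤ 2)
    {f g : EuclideanSpace ℝ (Fin n) → 𝕜} (hf : Continuous f) (hf' : HasCompactSupport f)
    (hg : Continuous g) (hg' : HasCompactSupport g) :
    2 * ∫⁻ y in Set.Ioi (0 : ℝ), ∫⁻ x : EuclideanSpace ℝ (Fin n),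
        ENNReal.ofReal (y * ‖fullGradient (poissonExtension f) x y‖ *
          ‖fullGradient (poissonExtension g) x y‖) ≤
      ENNReal.ofReal (1 / (p - 1)) * eLpNorm f (ENNReal.ofReal p) volume *
        eLpNorm g (ENNReal.ofReal q) volume := by
  have hp0 := hpq.pos
  have hq0 := hpq.symm.pos
  have hp1 : 0 < p - 1 := hpq.sub_one_pos
  set A := (1 / (p - 1)) ^ p * ∫ z, ‖f z‖ ^ p with hA
  set B := ∫ z, ‖g z‖ ^ q with hB
  have hA0 : 0 ≤ A := mul_nonneg (by positivity) (integral_nonneg fun z => by positivity)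
  have hB0 : 0 ≤ B := integral_nonneg fun z => by positivity
  set I := 2 * ∫⁻ y in Set.Ioi (0 : ℝ), ∫⁻ x : EuclideanSpace ℝ (Fin n),
        ENNReal.ofReal (y * ‖fullGradient (poissonExtension f) x y‖ *
          ‖fullGradient (poissonExtension g) x y‖) with hI
  have hscale : ∀ c : ℝ, 0 < c → I ≤ ENNReal.ofReal (c ^ p * A / p + c⁻¹ ^ q * B / q) := by
    intro c hc
    have h := bilinear_embedding_add (f := fun z => c • f z) (g := fun z => c⁻¹ • g z) hpq hp2
      (hf.const_smul c) (hf'.smul_left (f := fun _ => c))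
      (hg.const_smul c⁻¹) (hg'.smul_left (f := fun _ => c⁻¹))
    have e1 : ∀ z, ‖c • f z‖ ^ p = c ^ p * ‖f z‖ ^ p := fun z => by
      rw [norm_smul, Real.norm_of_nonneg hc.le, Real.mul_rpow hc.le (norm_nonneg _)]
    have e2 : ∀ z, ‖c⁻¹ • g z‖ ^ q = c⁻¹ ^ q * ‖g z‖ ^ q := fun z => by
      rw [norm_smul, Real.norm_of_nonneg (inv_nonneg.2 hc.le),
        Real.mul_rpow (inv_nonneg.2 hc.le) (norm_nonneg _)]
    simp only [e1, e2, integral_const_mul] at h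
    refine le_trans (le_of_eq ?_) (h.trans (le_of_eq ?_))
    · rw [hI]
      congr 1
      refine setLIntegral_congr_fun measurableSet_Ioi fun y hy => lintegral_congr fun x => ?_
      have h1 := norm_fullGradient_poissonExtension_smul hf hf' hc.le x hy
      have h2 := norm_fullGradient_poissonExtension_smul hg hg' (inv_nonneg.2 hc.le) x hy
      congr 1
      change _ = y * ‖fullGradient (poissonExtension (c • f)) x y‖ *
        ‖fullGradient (poissonExtension (c⁻¹ • g)) x y‖
      rw [h1, h2]
      field_simp
    · congr 1
      rw [hA]
      ring
  -- The optimal scaling requires both integrals to be positive; adding `η` and letting it tend to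
  -- `0` covers vanishing `f` or `g`.
  have hη : ∀ η : ℝ, 0 < η → I ≤ ENNReal.ofReal ((A + η) ^ (1 / p) * (B + η) ^ (1 / q)) := by
    intro η hη
    obtain ⟨c, hc, he⟩ := exists_scaling_eq hpq (A := A + η) (B := B + η) (by positivity)
      (by positivity)
    rw [← he]
    refine (hscale c hc).trans (ENNReal.ofReal_le_ofReal ?_)
    gcongr <;> linarith
  have hlim : Filter.Tendsto (fun η : ℝ =>
      ENNReal.ofReal ((A + η) ^ (1 / p) * (B + η) ^ (1 / q)))
      (nhdsWithin 0 (Set.Ioi 0)) (nhds (ENNReal.ofReal ((A + 0) ^ (1 / p) * (B + 0) ^ (1 / q)))) := by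
    refine ((ENNReal.continuous_ofReal.comp (Continuous.mul ?_ ?_)).tendsto _).mono_left
      nhdsWithin_le_nhds
    · exact (Real.continuous_rpow_const (by positivity)).comp (by fun_prop)
    · exact (Real.continuous_rpow_const (by positivity)).comp (by fun_prop)
  have hle := ge_of_tendsto hlim (Filter.eventually_of_mem self_mem_nhdsWithin hη)
  refine hle.trans (le_of_eq ?_)
  have hfm := hf.memLp_of_hasCompactSupport hf' (p := ENNReal.ofReal p) (μ := volume)
  have hgm := hg.memLp_of_hasCompactSupport hg' (p := ENNReal.ofReal q) (μ := volume)
  rw [hfm.eLpNorm_eq_integral_rpow_norm (by simpa using hp0) ENNReal.ofReal_ne_top,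
    hgm.eLpNorm_eq_integral_rpow_norm (by simpa using hq0) ENNReal.ofReal_ne_top,
    ENNReal.toReal_ofReal hp0.le, ENNReal.toReal_ofReal hq0.le,
    ← ENNReal.ofReal_mul (by positivity), ← ENNReal.ofReal_mul (by positivity), add_zero,
    add_zero, hA, Real.mul_rpow (by positivity) (integral_nonneg fun z => by positivity),
    ← Real.rpow_mul (by positivity), mul_one_div_cancel hp0.ne', Real.rpow_one, one_div p,
    one_div q]

end Bilinear

/-! ### The theorem for all exponents, by duality. -/

theorem mainTheorem2 {𝕜 : Type*} [RCLike 𝕜] (n : ℕ) (p q : ℝ) (hpq : p.HolderConjugate q)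
    (f g : EuclideanSpace ℝ (Fin n) → 𝕜)
    (hf : ContDiff ℝ ∞ f) (hf' : HasCompactSupport f)
    (hg : ContDiff ℝ ∞ g) (hg' : HasCompactSupport g) :
    2 * ∫⁻ y in Set.Ioi (0 : ℝ), ∫⁻ x : EuclideanSpace ℝ (Fin n),
        ENNReal.ofReal (y * ‖fullGradient (poissonExtension f) x y‖ *
          ‖fullGradient (poissonExtension g) x y‖) ≤
      ENNReal.ofReal (pStar p - 1) * eLpNorm f (ENNReal.ofReal p) volume *
        eLpNorm g (ENNReal.ofReal q) volume := by
  have hp1 := hpq.sub_one_pos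
  rcases le_total p 2 with hp2 | hp2
  · refine (bilinear_embedding_of_le_two hpq hp2 hf.continuous hf' hg.continuous hg').trans ?_
    gcongr
    have h1 : 1 / (p - 1) = p / (p - 1) - 1 := by field_simp; ring
    rw [h1, pStar]
    gcongr
    exact le_max_right _ _
  -- For `p ≥ 2` the roles of `f` and `g` are exchanged, and `1 / (q - 1) = p - 1`.
  · have hq2 : q ≤ 2 := by
      rw [hpq.conjugate_eq, div_le_iff₀ hp1]
      linarith
    have h := bilinear_embedding_of_le_two hpq.symm hq2 hg.continuous hg' hf.continuous hf'
    have h1 : 1 / (q - 1) = p - 1 := by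
      rw [hpq.conjugate_eq]; field_simp; ring
    rw [h1] at h
    calc _ = 2 * ∫⁻ y in Set.Ioi (0 : ℝ), ∫⁻ x : EuclideanSpace ℝ (Fin n),
          ENNReal.ofReal (y * ‖fullGradient (poissonExtension g) x y‖ *
            ‖fullGradient (poissonExtension f) x y‖) := by simp only [mul_right_comm]
      _ ≤ ENNReal.ofReal (p - 1) * eLpNorm g (ENNReal.ofReal q) volume *
            eLpNorm f (ENNReal.ofReal p) volume := h
      _ = ENNReal.ofReal (p - 1) * eLpNorm f (ENNReal.ofReal p) volume *
            eLpNorm g (ENNReal.ofReal q) volume := mul_right_comm _ _ _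
      _ ≤ _ := by
        gcongr
        exact le_max_left _ _
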